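/- Let $\mathbb{F}_q$ be a finite field of odd characteristic and let $C: y^2=f(x)$ be a curve of genus $2$ over $\mathbb{F}_q$, where $f\in\mathbb{F}_q[x]$ is monic of degree $5$ without multiple zeros. Let $\mathcal{O}$ be the point at infinity, $w:(X,Y)\mapsto(X,-Y)$ the hyperelliptic involution and $\varphi:(X,Y)\mapsto(X^q,Y^q)$ the Frobenius map (both fix $\mathcal{O}$ and extend to divisors on $C$ over $\overline{\mathbb{F}}_q$). For a polynomial $a\in\overline{\mathbb{F}}_q[x]$ let $a^\varphi$ be obtained by raising its coefficients to the power $q$. A divisor $P_1+\dots+P_r-r\mathcal{O}$ with $P_i\neq\mathcal{O}$ is semi-reduced if $P_i\neq w(P_j)$ for all $i\neq j$, and reduced if moreover $r\le 2$. The Mumford representation $[u,v]$ of a semi-reduced divisor $P_1+\dots+P_r-r\mathcal{O}$, $P_i=(X_i,Y_i)$, is given by $u=\prod_i(x-X_i)$ and the unique polynomial $v$ with $\deg v<\deg u$, $v(X_i)=Y_i$ for all $i$, and $u\mid v^2-f$. Let $\mathrm{Tr}(D)=D+\varphi(D)+\varphi^2(D)$, and let $T_3$ be the trace zero subgroup: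 the group of the classes $[D]\in\mathrm{Pic}^0(C)$ of the degree zero divisors $D$ with $\varphi^3(D)=D$ such that $\mathrm{Tr}(D)$ is principal. For a reduced divisor $D$ with $[D]\in T_3$, let $h_D\in\mathbb{F}_q(C)$ be the rational function, unique up to multiplication by a nonzero constant of $\mathbb{F}_q$, with $\mathrm{div}(h_D)=\mathrm{Tr}(D)$. **Proposition.** Let $D=P_1+P_2-2\mathcal{O}$ be a reduced divisor with $0\neq[D]\in T_3$ and Mumford representation $[u,v]$, such that $P_1\neq w(\varphi(P_2))$, $P_1\neq w(\varphi^2(P_2))$ and $\gcd(u,u^\varphi)=1$. Then the divisor $D+\varphi(D)$ is semi-reduced, and if $[U,V]$ is its Mumford representation, then $V\in\mathbb{F}_q[x]$ and, up to multiplication by a nonzero constant of $\mathbb{F}_q$, $$h_D = y-V .$$ That is, the functions $h\in\mathbb{F}_q(C)$ with $\mathrm{div}(h)=\mathrm{Tr}(D)$ are exactly the functions $c\,(y-V)$ with $c\in\mathbb{F}_q^*$. Moreover $$V = su+v,$$ where $s$ is the unique polynomial with $\deg s<\deg u^\varphi$ and $us\equiv v^\varphi-v \pmod{u^\varphi}$,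 i.e. $s\equiv (v^\varphi-v)/u \bmod u^\varphi$. -/

import Mathlib

open Polynomial

/-- An (elliptic or) hyperelliptic curve `y ^ 2 = f(x)` of genus `g` over a field `k` of
characteristic different from `2`, with one point at infinity: `f` is monic of degree `2 g + 1`
without multiple zeros. -/
structure HyperellipticCurve (k : Type*) [Field k] (g : ℕ) where
  f : k[X]
  monic : f.Monic
  natDegree_eq : f.natDegree = 2 * g + 1
  separable : f.Separable
  two_ne_zero : (2 : k) ≠ 0

noncomputable section

namespace HyperellipticCurve

variable {k : Type*} [Field k] {g : ℕ} (H : HyperellipticCurve k g)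
variable (K : Type*) [Field K] [Algebra k K]

/-- The affine coordinate ring `K[x, y] / (y ^ 2 - f(x))`. -/
abbrev CoordRing : Type _ :=
  AdjoinRoot (X ^ 2 - C (H.f.map (algebraMap k K)) : K[X][X])

theorem irreducible_equation :
    Irreducible (X ^ 2 - C (H.f.map (algebraMap k K)) : K[X][X]) := by
  have hm : (X ^ 2 - C (H.f.map (algebraMap k K)) : K[X][X]).Monic :=
    monic_X_pow_sub_C _ (by norm_num)
  have hd : (X ^ 2 - C (H.f.map (algebraMap k K)) : K[X][X]).natDegree = 2 :=
    natDegree_X_pow_sub_C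
  rw [hm.irreducible_iff_roots_eq_zero_of_degree_le_three (by omega) (by omega)]
  rw [Multiset.eq_zero_iff_forall_notMem]
  intro p hp
  have h0 := (mem_roots hm.ne_zero).1 hp
  have h1 : p ^ 2 = H.f.map (algebraMap k K) := by
    simpa [IsRoot, sub_eq_zero] using h0
  have h2 := congrArg natDegree h1
  rw [natDegree_pow, natDegree_map, H.natDegree_eq] at h2
  omega

instance : IsDomain (H.CoordRing K) :=
  AdjoinRoot.isDomain_of_prime (H.irreducible_equation K).prime

/-- The function field `K(C)`. -/
abbrev FunctionField : Type _ := FractionRing (H.CoordRing K)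

variable {K}

/-- A polynomial in `x`, as a regular function on the affine part of the curve. -/
def polyFun (p : K[X]) : H.CoordRing K := AdjoinRoot.of _ p

variable (K)

/-- The coordinate function `y`. -/
def yFun : H.CoordRing K := AdjoinRoot.root _

/-- The functions defined over the base field: the subfield `k(C) = k(x, y)` of `K(C)`. -/
def rationalFunctions : IntermediateField k (H.FunctionField K) :=
  IntermediateField.adjoin k
    {algebraMap (H.CoordRing K) (H.FunctionField K) (H.polyFun X),
      algebraMap (H.CoordRing K) (H.FunctionField K) (H.yFun K)}

/-- The points of the affine curve with coordinates in `K`. -/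
@[ext]
structure AffinePoint where
  x : K
  y : K
  equation : y ^ 2 = aeval x H.f

/-- The points of the projective curve; `none` is the point `O` at infinity. -/
abbrev Point : Type _ := Option (H.AffinePoint K)

/-- Divisors on the curve (for `K` algebraically closed). -/
abbrev Divisor : Type _ := H.Point K →₀ ℤ

variable {K} {H}

/-- The hyperelliptic involution. -/
def AffinePoint.w (P : H.AffinePoint K) : H.AffinePoint K where
  x := P.x
  y := -P.y
  equation := by rw [neg_sq, P.equation]

/-- The maximal ideal `(x - X_P, y - Y_P)` of the coordinate ring. -/
def AffinePoint.ideal (P : H.AffinePoint K) : Ideal (H.CoordRing K) :=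
  Ideal.span {H.polyFun (X - C P.x), H.yFun K - H.polyFun (C P.y)}

/-- The order of a nonzero regular function `r` at a point: at an affine point `P` it is the
largest `n` with `r ∈ m_P ^ n`; at infinity it is minus the degree of the norm of `r` to `K[x]`
(so that `x` has a pole of order `2` and `y` a pole of order `2 g + 1`). -/
def ordRegular (r : H.CoordRing K) : H.Point K → ℤ
  | some P => ((emultiplicity P.ideal (Ideal.span {r})).toNat : ℤ)
  | none => -((Algebra.norm K[X] r).natDegree : ℤ)

/-- The order of a nonzero rational function at a point: the order of a numerator minus the order
of a denominator. -/
def ord (P : H.Point K) (h : H.FunctionField K) : ℤ :=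
  ordRegular (IsLocalization.sec (nonZeroDivisors (H.CoordRing K)) h).1 P
    - ordRegular ((IsLocalization.sec (nonZeroDivisors (H.CoordRing K)) h).2 : H.CoordRing K) P

/-- `div(h) = D`, for a nonzero rational function `h`. -/
def HasDivisor (h : H.FunctionField K) (D : H.Divisor K) : Prop :=
  h ≠ 0 ∧ ∀ P : H.Point K, ord P h = D P

variable (H) (K)

/-- The group of principal divisors. -/
def principal : AddSubgroup (H.Divisor K) :=
  AddSubgroup.closure {D | ∃ h : H.FunctionField K, HasDivisor h D}

/-- The group of divisors of degree zero. -/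
def DivZero : AddSubgroup (H.Divisor K) :=
  (Finsupp.liftAddHom fun _ : H.Point K => AddMonoidHom.id ℤ).ker

/-- The Picard group of degree zero divisor classes. -/
abbrev Pic : Type _ := H.DivZero K ⧸ (H.principal K).addSubgroupOf (H.DivZero K)

variable {H} {K}

/-- The class `[D]` of a divisor of degree zero. -/
def divClass (D : H.DivZero K) : H.Pic K :=
  QuotientAddGroup.mk' ((H.principal K).addSubgroupOf (H.DivZero K)) D

/-- `D = P_1 + … + P_r - r O`, with affine points `P_i` such that `P_i ≠ w(P_j)` for `i ≠ j`. -/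
def IsSemiReducedSum (D : H.Divisor K) (r : ℕ) (P : Fin r → H.AffinePoint K) : Prop :=
  D = ∑ i, Finsupp.single (some (P i)) 1 - (r : ℤ) • Finsupp.single none 1 ∧
    ∀ i j, i ≠ j → P i ≠ (P j).w

def IsSemiReduced (D : H.Divisor K) : Prop :=
  ∃ (r : ℕ) (P : Fin r → H.AffinePoint K), IsSemiReducedSum D r P

def IsReduced (D : H.Divisor K) : Prop :=
  ∃ (r : ℕ) (P : Fin r → H.AffinePoint K), IsSemiReducedSum D r P ∧ r ≤ g

/-- `[u, v]` is the Mumford representation of the semi-reduced divisor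
`D = P_1 + … + P_r - r O`, `P_i = (X_i, Y_i)`: one has `u = ∏ (x - X_i)`, `deg v < deg u`,
and `v(X_i) = Y_i` with the right multiplicities, that is, `u ∣ v ^ 2 - f`. -/
def IsMumford (D : H.Divisor K) (u v : K[X]) : Prop :=
  ∃ (r : ℕ) (P : Fin r → H.AffinePoint K), IsSemiReducedSum D r P ∧
    u = ∏ i, (X - C (P i).x) ∧ v.degree < u.degree ∧
    (∀ i, v.eval (P i).x = (P i).y) ∧ u ∣ v ^ 2 - H.f.map (algebraMap k K)

section Frobenius

variable [Fintype k]

/-- The Frobenius map `(X, Y) ↦ (X ^ q, Y ^ q)`, `q = #k`. -/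
def AffinePoint.frob (P : H.AffinePoint K) : H.AffinePoint K where
  x := P.x ^ Fintype.card k
  y := P.y ^ Fintype.card k
  equation := by
    have h := congrArg (FiniteField.frobeniusAlgHom k K) P.equation
    rw [map_pow, ← aeval_algHom_apply] at h
    simpa using h

variable (k) in
/-- The polynomial `u ^ φ`: the `q`-Frobenius, `q = #k`, applied to the coefficients of `u`. -/
def frobPoly (u : K[X]) : K[X] := u.map (FiniteField.frobeniusAlgHom k K : K →+* K)

variable (H) (K)

/-- The Frobenius endomorphism `φ` of the group of divisors (it fixes the point at infinity). -/
def frobDiv : AddMonoid.End (H.Divisor K) :=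
  Finsupp.mapDomain.addMonoidHom (Option.map AffinePoint.frob)

/-- The trace `D ↦ D + φ(D) + … + φ^(n-1)(D)`. -/
def trace (n : ℕ) : AddMonoid.End (H.Divisor K) :=
  ∑ i ∈ Finset.range n, H.frobDiv K ^ i

/-- The divisors that are rational over the extension of degree `n` of `k`: `φ^n(D) = D`. -/
def rationalDivisors (n : ℕ) : AddSubgroup (H.Divisor K) :=
  AddMonoidHom.eqLocus (H.frobDiv K ^ n : AddMonoid.End (H.Divisor K))
    (1 : AddMonoid.End (H.Divisor K))

/-- The trace zero subgroup `T_n`: the classes `[D]` of the divisors `D` of degree zero that are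
rational over the extension of degree `n` of `k` and whose trace is principal. -/
def traceZero (n : ℕ) : AddSubgroup (H.Pic K) :=
  ((H.rationalDivisors K n ⊓ (H.principal K).comap (H.trace K n)).addSubgroupOf
    (H.DivZero K)).map (QuotientAddGroup.mk' _)

variable {H} {K}

/-- `h` is a function `h_D`, that is, a function in `k(C)` with `div(h) = Tr(D)`, where the trace
is taken with respect to the extension of degree `n` of `k`. -/
def IsTraceFunction (n : ℕ) (D : H.Divisor K) (h : H.FunctionField K) : Prop :=
  h ∈ H.rationalFunctions K ∧ HasDivisor h (H.trace K n D)

end Frobenius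

end HyperellipticCurve

end

noncomputable section

namespace HyperellipticCurve

variable {k : Type*} [Field k] {g : ℕ} (H : HyperellipticCurve k g)
variable {K : Type*} [Field K] [Algebra k K]

theorem monic_equation :
    (X ^ 2 - C (H.f.map (algebraMap k K)) : K[X][X]).Monic :=
  monic_X_pow_sub_C _ (by norm_num)

theorem natDegree_equation :
    (X ^ 2 - C (H.f.map (algebraMap k K)) : K[X][X]).natDegree = 2 :=
  natDegree_X_pow_sub_C

theorem yFun_sq : H.yFun K ^ 2 = H.polyFun (H.f.map (algebraMap k K)) := by
  have h := AdjoinRoot.eval₂_root (X ^ 2 - C (H.f.map (algebraMap k K)) : K[X][X])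
  rw [eval₂_sub, eval₂_pow, eval₂_X, eval₂_C, sub_eq_zero] at h
  exact h

@[simp] theorem polyFun_zero : H.polyFun (0 : K[X]) = 0 := map_zero _
@[simp] theorem polyFun_one : H.polyFun (1 : K[X]) = 1 := map_one _
@[simp] theorem polyFun_add (a b : K[X]) : H.polyFun (a + b) = H.polyFun a + H.polyFun b :=
  map_add _ _ _
@[simp] theorem polyFun_sub (a b : K[X]) : H.polyFun (a - b) = H.polyFun a - H.polyFun b :=
  map_sub _ _ _
@[simp] theorem polyFun_neg (a : K[X]) : H.polyFun (-a) = -H.polyFun a :=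
  map_neg _ _
@[simp] theorem polyFun_mul (a b : K[X]) : H.polyFun (a * b) = H.polyFun a * H.polyFun b :=
  map_mul _ _ _
@[simp] theorem polyFun_pow (a : K[X]) (n : ℕ) : H.polyFun (a ^ n) = H.polyFun a ^ n :=
  map_pow _ _ _

/-- Every regular function on the affine curve is `a(x) + b(x) y`. -/
theorem exists_eq_add_mul_yFun (r : H.CoordRing K) :
    ∃ a b : K[X], r = H.polyFun a + H.polyFun b * H.yFun K := by
  obtain ⟨p, rfl⟩ := AdjoinRoot.mk_surjective r
  have hd := natDegree_modByMonic_lt p (H.monic_equation (K := K))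
    (fun h => by have := congrArg natDegree h; rw [natDegree_equation] at this; simp at this)
  rw [natDegree_equation] at hd
  obtain ⟨b, a, hab⟩ := exists_eq_X_add_C_of_natDegree_le_one (Nat.lt_succ_iff.1 hd)
  refine ⟨a, b, ?_⟩
  rw [← AdjoinRoot.mk_leftInverse H.monic_equation (AdjoinRoot.mk _ p),
    AdjoinRoot.modByMonicHom_mk, hab, map_add, map_mul, AdjoinRoot.mk_X, AdjoinRoot.mk_C,
    AdjoinRoot.mk_C, add_comm]
  rfl

/-- The basis `1, y` of the coordinate ring over `K[x]`. -/
def coordBasis (K : Type*) [Field K] [Algebra k K] : Module.Basis (Fin 2) K[X] (H.CoordRing K) :=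
  (AdjoinRoot.powerBasis' (H.monic_equation (K := K))).basis.reindex
    (finCongr H.natDegree_equation)

theorem coordBasis_zero : H.coordBasis K 0 = 1 := by
  simp only [coordBasis, Module.Basis.reindex_apply, PowerBasis.coe_basis]
  exact pow_zero _

theorem coordBasis_one : H.coordBasis K 1 = H.yFun K := by
  simp only [coordBasis, Module.Basis.reindex_apply, PowerBasis.coe_basis]
  exact pow_one _

instance : Module.Finite K[X] (H.CoordRing K) := Module.Finite.of_basis (H.coordBasis K)

theorem norm_eq (a b : K[X]) :
    Algebra.norm K[X] (H.polyFun a + H.polyFun b * H.yFun K) =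
      a ^ 2 - H.f.map (algebraMap k K) * b ^ 2 := by
  have key : ∀ c d : K[X], H.polyFun c + H.polyFun d * H.yFun K =
      c • H.coordBasis K 0 + d • H.coordBasis K 1 := fun c d => by
    rw [coordBasis_zero, coordBasis_one, Algebra.smul_def, Algebra.smul_def, mul_one]; rfl
  have h0 : (H.polyFun a + H.polyFun b * H.yFun K) * H.coordBasis K 0 =
      a • H.coordBasis K 0 + b • H.coordBasis K 1 := by
    rw [← key, coordBasis_zero, mul_one]
  have h1 : (H.polyFun a + H.polyFun b * H.yFun K) * H.coordBasis K 1 =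
      (b * H.f.map (algebraMap k K)) • H.coordBasis K 0 + a • H.coordBasis K 1 := by
    rw [← key, coordBasis_one, polyFun_mul, ← yFun_sq]; ring
  rw [Algebra.norm_eq_matrix_det (H.coordBasis K), Matrix.det_fin_two]
  simp only [Algebra.leftMulMatrix_eq_repr_mul, h0, h1, map_add, map_smul, Finsupp.add_apply,
    Finsupp.smul_apply, Module.Basis.repr_self, smul_eq_mul]
  simp
  ring

theorem polyFun_injective : Function.Injective (H.polyFun (K := K)) := by
  refine AdjoinRoot.of.injective_of_degree_ne_zero ?_
  rw [degree_X_pow_sub_C (by norm_num)]; norm_num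

instance : FaithfulSMul K[X] (H.CoordRing K) :=
  (faithfulSMul_iff_algebraMap_injective _ _).2 H.polyFun_injective

theorem polyFun_ne_zero {a : K[X]} (ha : a ≠ 0) : H.polyFun a ≠ 0 := fun h =>
  ha (H.polyFun_injective (h.trans H.polyFun_zero.symm))

theorem norm_ne_zero {r : H.CoordRing K} (hr : r ≠ 0) : Algebra.norm K[X] r ≠ 0 :=
  (Algebra.norm_ne_zero_iff_of_basis (H.coordBasis K)).2 hr

theorem natDegree_map_f : (H.f.map (algebraMap k K)).natDegree = 2 * g + 1 := by
  rw [natDegree_map, H.natDegree_eq]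

theorem map_f_ne_zero : H.f.map (algebraMap k K) ≠ 0 :=
  (H.monic.map _).ne_zero

theorem two_ne_zero_of_curve (H : HyperellipticCurve k g) : (2 : K) ≠ 0 := by
  have h := (map_ne_zero (algebraMap k K)).2 H.two_ne_zero
  rwa [map_ofNat] at h

theorem norm_polyFun (a : K[X]) : Algebra.norm K[X] (H.polyFun a) = a ^ 2 := by
  simpa using H.norm_eq a 0

/-- The degree of the norm: the two terms cannot cancel, having degrees of different parity. -/
theorem natDegree_norm (a : K[X]) {b : K[X]} (hb : b ≠ 0) :
    (Algebra.norm K[X] (H.polyFun a + H.polyFun b * H.yFun K)).natDegree =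
      max (2 * a.natDegree) (2 * b.natDegree + 2 * g + 1) := by
  rw [norm_eq]
  have h1 : (H.f.map (algebraMap k K) * b ^ 2).natDegree = 2 * b.natDegree + 2 * g + 1 := by
    rw [natDegree_mul H.map_f_ne_zero (pow_ne_zero _ hb), natDegree_pow, natDegree_map_f]
    omega
  have h2 : (a ^ 2).natDegree = 2 * a.natDegree := natDegree_pow _ _
  rcases lt_trichotomy (2 * a.natDegree) (2 * b.natDegree + 2 * g + 1) with h | h | h
  · rw [natDegree_sub_eq_right_of_natDegree_lt (by omega), h1, max_eq_right h.le]
  · omega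
  · rw [natDegree_sub_eq_left_of_natDegree_lt (by omega), h2, max_eq_left h.le]

/-- The conjugation `y ↦ -y` of the coordinate ring. -/
def conj (K : Type*) [Field K] [Algebra k K] : H.CoordRing K →ₐ[K[X]] H.CoordRing K :=
  AdjoinRoot.liftAlgHom _ (Algebra.ofId K[X] (H.CoordRing K)) (-H.yFun K) (by
    rw [eval₂_sub, eval₂_pow, eval₂_X, eval₂_C, neg_sq, yFun_sq, sub_eq_zero]; rfl)

@[simp] theorem conj_yFun : H.conj K (H.yFun K) = -H.yFun K :=
  AdjoinRoot.liftAlgHom_root _ _ _ _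

@[simp] theorem conj_polyFun (a : K[X]) : H.conj K (H.polyFun a) = H.polyFun a :=
  (H.conj K).commutes a

@[simp] theorem conj_conj (r : H.CoordRing K) : H.conj K (H.conj K r) = r := by
  obtain ⟨a, b, rfl⟩ := H.exists_eq_add_mul_yFun r
  simp

theorem conj_injective : Function.Injective (H.conj K) :=
  (show Function.Involutive (H.conj K) from H.conj_conj).injective

theorem mul_conj (r : H.CoordRing K) : r * H.conj K r = H.polyFun (Algebra.norm K[X] r) := by
  obtain ⟨a, b, rfl⟩ := H.exists_eq_add_mul_yFun r
  rw [norm_eq]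
  simp [← yFun_sq]
  ring

section IntegrallyClosed

/-- A quotient of polynomials in the function field that is integral over `K[x]` is a
polynomial. -/
theorem dvd_of_isIntegral {a d : K[X]} (hd : d ≠ 0) {z : H.FunctionField K}
    (hz : z * algebraMap K[X] (H.FunctionField K) d = algebraMap K[X] (H.FunctionField K) a)
    (hint : IsIntegral K[X] z) : d ∣ a := by
  have hinj : Function.Injective (Algebra.ofId K[X] (H.FunctionField K)) :=
    FaithfulSMul.algebraMap_injective K[X] (H.FunctionField K)
  let φ : FractionRing K[X] →ₐ[K[X]] H.FunctionField K := IsFractionRing.liftAlgHom hinj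
  have hd' : algebraMap K[X] (FractionRing K[X]) d ≠ 0 := by simpa using hd
  have hd'' : algebraMap K[X] (H.FunctionField K) d ≠ 0 := by
    rw [Ne, FaithfulSMul.algebraMap_eq_zero_iff]; exact hd
  have hφ : φ (algebraMap _ _ a / algebraMap _ _ d) = z := by
    rw [map_div₀, φ.commutes, φ.commutes, ← hz, mul_div_cancel_right₀ _ hd'']
  rw [← hφ, isIntegral_algHom_iff φ φ.toRingHom.injective] at hint
  obtain ⟨c, hc⟩ := IsIntegrallyClosed.isIntegral_iff.1 hint
  refine ⟨c, FaithfulSMul.algebraMap_injective K[X] (FractionRing K[X]) ?_⟩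
  rw [map_mul, hc, mul_div_cancel₀ _ hd']

instance : IsIntegrallyClosed (H.CoordRing K) := by
  refine (isIntegrallyClosed_iff (H.FunctionField K)).2 fun {z} hz => ?_
  have hz1 : IsIntegral K[X] z := isIntegral_trans z hz
  obtain ⟨r, s, hs, rfl⟩ := IsFractionRing.div_surjective (A := H.CoordRing K) z
  have hs0 : s ≠ 0 := nonZeroDivisors.ne_zero hs
  set d := Algebra.norm K[X] s with hd
  have hd0 : d ≠ 0 := H.norm_ne_zero hs0
  obtain ⟨a, b, hab⟩ := H.exists_eq_add_mul_yFun (r * H.conj K s)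
  set z := algebraMap (H.CoordRing K) (H.FunctionField K) r / algebraMap _ _ s with hzdef
  have hs1 : algebraMap (H.CoordRing K) (H.FunctionField K) s ≠ 0 := by simpa using hs0
  let ι : H.CoordRing K →ₐ[K[X]] H.FunctionField K :=
    IsScalarTower.toAlgHom K[X] (H.CoordRing K) (H.FunctionField K)
  have hι : Function.Injective ι := IsFractionRing.injective (H.CoordRing K) (H.FunctionField K)
  have hpoly : ∀ p : K[X], ι (H.polyFun p) = algebraMap K[X] (H.FunctionField K) p :=
    fun p => ι.commutes p
  have hzd : z * ι (H.polyFun d) = ι (H.polyFun a + H.polyFun b * H.yFun K) := by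
    rw [← hab, hd, ← mul_conj, map_mul, map_mul, hzdef, ← mul_assoc]
    congr 1
    exact div_mul_cancel₀ _ hs1
  let τ : H.FunctionField K →ₐ[K[X]] H.FunctionField K :=
    IsFractionRing.liftAlgHom (g := ι.comp (H.conj K)) (hι.comp H.conj_injective)
  have hτ : ∀ x : H.CoordRing K, τ (ι x) = ι (H.conj K x) := fun x =>
    IsFractionRing.lift_algebraMap (g := (ι.comp (H.conj K)).toRingHom)
      (hι.comp H.conj_injective) x
  have hτz := hz1.map τ
  have hzd' : τ z * ι (H.polyFun d) = ι (H.polyFun a - H.polyFun b * H.yFun K) := by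
    have := congrArg τ hzd
    rw [map_mul, hτ, hτ] at this
    simpa [sub_eq_add_neg] using this
  have h2a : d ∣ 2 * a := by
    refine H.dvd_of_isIntegral hd0 (z := z + τ z) ?_ (hz1.add hτz)
    rw [← hpoly, ← hpoly, add_mul, hzd, hzd', ← map_add]
    congr 1
    rw [polyFun_mul, show H.polyFun (2 : K[X]) = 2 from map_ofNat _ 2]
    ring
  have hnorm : d ^ 2 ∣ a ^ 2 - H.f.map (algebraMap k K) * b ^ 2 := by
    refine H.dvd_of_isIntegral (pow_ne_zero 2 hd0) (z := z * τ z) ?_ (hz1.mul hτz)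
    rw [← hpoly, ← hpoly, polyFun_pow, map_pow, sq (ι _), mul_mul_mul_comm, hzd, hzd', ← map_mul]
    congr 1
    rw [polyFun_sub, polyFun_mul, ← yFun_sq, polyFun_pow, polyFun_pow]
    ring
  have h2 : IsUnit (2 : K[X]) := by
    rw [show (2 : K[X]) = C 2 from (map_ofNat C 2).symm]
    exact isUnit_C.2 (isUnit_iff_ne_zero.2 H.two_ne_zero_of_curve)
  have ha : d ∣ a := (h2.dvd_mul_left).1 h2a
  have hfb : d ^ 2 ∣ H.f.map (algebraMap k K) * b ^ 2 :=
    (dvd_sub_right (pow_dvd_pow_of_dvd ha 2)).1 hnorm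
  have hsq : Squarefree (H.f.map (algebraMap k K)) := (H.separable.map).squarefree
  have hb : d ∣ b := by
    have hdfb : d ∣ H.f.map (algebraMap k K) * b := by
      rw [← IsIntegrallyClosed.pow_dvd_pow_iff _root_.two_ne_zero, mul_pow, sq (map _ _), mul_assoc]
      exact hfb.mul_left _
    obtain ⟨c, hc⟩ := hdfb
    have hfc : H.f.map (algebraMap k K) ∣ c := by
      rw [← hsq.dvd_pow_iff_dvd _root_.two_ne_zero]
      refine (mul_dvd_mul_iff_left (pow_ne_zero 2 hd0)).1 ?_
      rw [← mul_pow, ← hc, mul_pow, sq (map _ _), mul_assoc, mul_comm (d ^ 2)]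
      exact mul_dvd_mul_left _ hfb
    obtain ⟨c', rfl⟩ := hfc
    exact ⟨c', mul_left_cancel₀ H.map_f_ne_zero (by rw [hc]; ring)⟩
  obtain ⟨a', rfl⟩ := ha
  obtain ⟨b', rfl⟩ := hb
  refine ⟨H.polyFun a' + H.polyFun b' * H.yFun K, ?_⟩
  refine mul_right_cancel₀ (b := ι (H.polyFun d)) ?_ (Eq.trans ?_ hzd.symm)
  · rw [Ne, map_eq_zero_iff ι hι]; exact H.polyFun_ne_zero hd0
  · change ι _ * ι _ = _
    rw [← map_mul]
    congr 1
    simp only [polyFun_mul]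
    ring

end IntegrallyClosed

end HyperellipticCurve

end

noncomputable section

namespace HyperellipticCurve

variable {k : Type*} [Field k] {g : ℕ} {H : HyperellipticCurve k g}
variable {K : Type*} [Field K] [Algebra k K]

theorem AffinePoint.eval_f (P : H.AffinePoint K) :
    (H.f.map (algebraMap k K)).eval P.x = P.y ^ 2 := by
  rw [P.equation, eval_map_algebraMap]

@[simp] theorem AffinePoint.w_x (P : H.AffinePoint K) : P.w.x = P.x := rfl
@[simp] theorem AffinePoint.w_y (P : H.AffinePoint K) : P.w.y = -P.y := rfl

@[simp] theorem AffinePoint.w_w (P : H.AffinePoint K) : P.w.w = P :=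
  AffinePoint.ext rfl (neg_neg _)

theorem AffinePoint.eq_or_eq_w {P Q : H.AffinePoint K} (h : P.x = Q.x) : P = Q ∨ P = Q.w := by
  have h2 : P.y ^ 2 = Q.y ^ 2 := by rw [← P.eval_f, ← Q.eval_f, h]
  exact (sq_eq_sq_iff_eq_or_eq_neg.1 h2).imp (AffinePoint.ext h) (AffinePoint.ext h)

theorem AffinePoint.eq_w_iff (P : H.AffinePoint K) : P = P.w ↔ P.y = 0 := by
  refine ⟨fun h => ?_, fun h => AffinePoint.ext rfl (by simp [h])⟩
  have h1 : P.y = -P.y := congrArg AffinePoint.y h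
  have h2 : 2 * P.y = 0 := by linear_combination h1
  exact (mul_eq_zero.1 h2).resolve_left H.two_ne_zero_of_curve

/-- Evaluation of regular functions at an affine point. -/
def AffinePoint.eval (P : H.AffinePoint K) : H.CoordRing K →+* K :=
  AdjoinRoot.lift (evalRingHom P.x) P.y (by
    rw [eval₂_sub, eval₂_pow, eval₂_X, eval₂_C, coe_evalRingHom, P.eval_f, sub_self])

@[simp] theorem AffinePoint.eval_yFun (P : H.AffinePoint K) : P.eval (H.yFun K) = P.y :=
  AdjoinRoot.lift_root _

@[simp] theorem AffinePoint.eval_polyFun (P : H.AffinePoint K) (a : K[X]) :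
    P.eval (H.polyFun a) = a.eval P.x :=
  AdjoinRoot.lift_of _

theorem AffinePoint.ker_eval (P : H.AffinePoint K) : RingHom.ker P.eval = P.ideal := by
  refine le_antisymm (fun r hr => ?_) ?_
  · obtain ⟨a, b, rfl⟩ := H.exists_eq_add_mul_yFun r
    have hr' : a.eval P.x + b.eval P.x * P.y = 0 := by
      simpa [RingHom.mem_ker] using hr
    obtain ⟨c, hc⟩ : X - C P.x ∣ a + b * C P.y := by
      rw [dvd_iff_isRoot]
      simpa [IsRoot] using hr'
    have key : H.polyFun a + H.polyFun b * H.yFun K =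
        H.polyFun c * H.polyFun (X - C P.x) + H.polyFun b * (H.yFun K - H.polyFun (C P.y)) := by
      rw [← polyFun_mul, mul_comm c, ← hc]
      simp
      ring
    rw [key]
    refine add_mem (Ideal.mul_mem_left _ _ ?_) (Ideal.mul_mem_left _ _ ?_) <;>
      exact Ideal.subset_span (by simp)
  · rw [AffinePoint.ideal, Ideal.span_le]
    rintro r (rfl | rfl) <;> simp [RingHom.mem_ker]

theorem AffinePoint.mem_ideal {P : H.AffinePoint K} {r : H.CoordRing K} :
    r ∈ P.ideal ↔ P.eval r = 0 := by
  rw [← P.ker_eval, RingHom.mem_ker]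

instance (P : H.AffinePoint K) : P.ideal.IsMaximal := by
  rw [← P.ker_eval]
  exact RingHom.ker_isMaximal_of_surjective _ fun c => ⟨H.polyFun (C c), by simp⟩

theorem AffinePoint.ideal_injective :
    Function.Injective (AffinePoint.ideal : H.AffinePoint K → Ideal (H.CoordRing K)) := by
  intro P Q h
  have h1 : H.polyFun (X - C Q.x) ∈ P.ideal := by
    rw [h, mem_ideal]; simp
  have h2 : H.yFun K - H.polyFun (C Q.y) ∈ P.ideal := by
    rw [h, mem_ideal]; simp
  rw [mem_ideal] at h1 h2
  exact AffinePoint.ext (by simpa [sub_eq_zero] using h1) (by simpa [sub_eq_zero] using h2)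

theorem AffinePoint.ideal_ne_bot (P : H.AffinePoint K) : P.ideal ≠ ⊥ := by
  intro h
  have h1 : H.polyFun (X - C P.x) ∈ P.ideal := by rw [mem_ideal]; simp
  rw [h, Ideal.mem_bot] at h1
  exact H.polyFun_ne_zero (X_sub_C_ne_zero _) h1

/-- The fibre of `x` over `x_P` is `P + w(P)`. -/
theorem AffinePoint.span_X_sub_C (P : H.AffinePoint K) :
    Ideal.span {H.polyFun (X - C P.x)} = P.ideal * P.w.ideal := by
  obtain ⟨q, hq⟩ : X - C P.x ∣ H.f.map (algebraMap k K) - C (P.y ^ 2) := by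
    rw [dvd_iff_isRoot, IsRoot, eval_sub, eval_C, P.eval_f, sub_self]
  have hyy : (H.yFun K - H.polyFun (C P.y)) * (H.yFun K - H.polyFun (C P.w.y)) =
      H.polyFun (X - C P.x) * H.polyFun q := by
    rw [← polyFun_mul, ← hq, polyFun_sub, ← yFun_sq]
    simp
    ring
  apply le_antisymm
  · rw [Ideal.span_singleton_le_iff_mem]
    have hx : H.polyFun (X - C P.x) ∈ P.ideal := by rw [mem_ideal]; simp
    have hx' : H.polyFun (X - C P.x) ∈ P.w.ideal := by rw [mem_ideal]; simp
    have hy : H.yFun K - H.polyFun (C P.y) ∈ P.ideal := by rw [mem_ideal]; simp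
    have hy' : H.yFun K - H.polyFun (C P.w.y) ∈ P.w.ideal := by rw [mem_ideal]; simp
    by_cases h : P.y = 0
    · have hf : H.f.map (algebraMap k K) = (X - C P.x) * q := by rw [← hq]; simp [h]
      have hsep : (H.f.map (algebraMap k K)).Separable := H.separable.map
      rw [hf] at hsep
      obtain ⟨s, t, hst⟩ := hsep.isCoprime
      have hmem := add_mem (Ideal.mul_mem_left _ (H.polyFun s) (Ideal.mul_mem_mul hx hx'))
        (Ideal.mul_mem_left _ (H.polyFun t) (Ideal.mul_mem_mul hy hy'))
      convert hmem using 1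
      rw [hyy]
      simp only [← polyFun_mul, ← polyFun_add]
      congr 1
      linear_combination (-(X - C P.x)) * hst
    · have hmem := Ideal.mul_mem_left _ (H.polyFun (C (2 * P.y)⁻¹))
        (sub_mem (Ideal.mul_mem_mul hx hy') (Ideal.mul_mem_mul hy hx'))
      convert hmem using 1
      have h2 : 2 * P.y ≠ 0 := mul_ne_zero H.two_ne_zero_of_curve h
      have h3 : H.polyFun (C (2 * P.y)⁻¹) * (H.polyFun (C P.y) - H.polyFun (C P.w.y)) = 1 := by
        rw [← polyFun_sub, ← polyFun_mul, ← C_sub, ← C_mul, w_y, sub_neg_eq_add, ← two_mul,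
          inv_mul_cancel₀ h2, C_1, polyFun_one]
      linear_combination (-H.polyFun (X - C P.x)) * h3
  · rw [AffinePoint.ideal, AffinePoint.ideal, Ideal.span_pair_mul_span_pair, Ideal.span_le]
    have hx : H.polyFun (X - C P.x) ∈ Ideal.span {H.polyFun (X - C P.x)} :=
      Ideal.mem_span_singleton_self _
    rintro r (rfl | rfl | rfl | rfl)
    · exact Ideal.mul_mem_right _ _ hx
    · exact Ideal.mul_mem_right _ _ hx
    · exact Ideal.mul_mem_left _ _ hx
    · rw [hyy]; exact Ideal.mul_mem_right _ _ hx

section AlgClosed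

variable [IsAlgClosed K]

theorem exists_affinePoint (H : HyperellipticCurve k g) (α : K) :
    ∃ P : H.AffinePoint K, P.x = α := by
  obtain ⟨β, hβ⟩ := IsAlgClosed.exists_pow_nat_eq (aeval α H.f) (n := 2) (by norm_num)
  exact ⟨⟨α, β, hβ⟩, rfl⟩

theorem exists_ideal_eq {p : Ideal (H.CoordRing K)} (hp : p.IsPrime) (h0 : p ≠ ⊥) :
    ∃ P : H.AffinePoint K, P.ideal = p := by
  obtain ⟨r, hr, hr0⟩ := Submodule.exists_mem_ne_zero_of_ne_bot h0
  have hn : H.polyFun (Algebra.norm K[X] r) ∈ p := by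
    rw [← mul_conj]; exact p.mul_mem_right _ hr
  have hprod := (IsAlgClosed.splits (Algebra.norm K[X] r)).eq_prod_roots
  obtain ⟨α, hα⟩ : ∃ α, H.polyFun (X - C α) ∈ p := by
    rw [hprod, polyFun_mul] at hn
    rcases hp.mem_or_mem hn with h | h
    · exfalso
      refine hp.ne_top (Ideal.eq_top_of_isUnit_mem _ h ?_)
      refine IsUnit.map (AdjoinRoot.of _) (isUnit_C.2 (isUnit_iff_ne_zero.2 ?_))
      exact leadingCoeff_ne_zero.2 (H.norm_ne_zero hr0)
    · rw [show H.polyFun (Multiset.map (fun a => X - C a) (Algebra.norm K[X] r).roots).prod =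
        (Multiset.map (AdjoinRoot.of _) (Multiset.map (fun a => X - C a)
          (Algebra.norm K[X] r).roots)).prod from map_multiset_prod _ _, Multiset.map_map] at h
      obtain ⟨x, hx, hxp⟩ := (hp.multiset_prod_mem_iff_exists_mem _).1 h
      obtain ⟨a, -, rfl⟩ := Multiset.mem_map.1 hx
      exact ⟨a, hxp⟩
  obtain ⟨P, rfl⟩ := H.exists_affinePoint α
  have hle : P.ideal * P.w.ideal ≤ p := by
    rw [← P.span_X_sub_C, Ideal.span_singleton_le_iff_mem]; exact hα
  rcases (Ideal.IsPrime.mul_le hp).1 hle with h | h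
  · exact ⟨P, Ideal.IsMaximal.eq_of_le inferInstance hp.ne_top h⟩
  · exact ⟨P.w, Ideal.IsMaximal.eq_of_le inferInstance hp.ne_top h⟩

instance : IsDedekindDomain (H.CoordRing K) :=
  { (inferInstance : IsDomain (H.CoordRing K)),
    IsNoetherianRing.of_finite K[X] (H.CoordRing K),
    (inferInstance : IsIntegrallyClosed (H.CoordRing K)) with
    maximalOfPrime := fun h0 hp => by
      obtain ⟨P, rfl⟩ := exists_ideal_eq hp h0
      infer_instance }

end AlgClosed

end HyperellipticCurve

end

noncomputable section

namespace HyperellipticCurve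

variable {k : Type*} [Field k] {g : ℕ} {H : HyperellipticCurve k g}
variable {K : Type*} [Field K] [Algebra k K] [IsAlgClosed K]

theorem AffinePoint.prime_ideal (P : H.AffinePoint K) : Prime P.ideal :=
  Ideal.prime_of_isPrime P.ideal_ne_bot inferInstance

omit [IsAlgClosed K] in
theorem span_singleton_ne_zero {r : H.CoordRing K} (hr : r ≠ 0) :
    (Ideal.span {r} : Ideal (H.CoordRing K)) ≠ 0 := by
  rwa [Ideal.zero_eq_bot, Ne, Ideal.span_singleton_eq_bot]

theorem AffinePoint.finiteMultiplicity (P : H.AffinePoint K) {r : H.CoordRing K} (hr : r ≠ 0) :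
    FiniteMultiplicity P.ideal (Ideal.span {r}) :=
  FiniteMultiplicity.of_prime_left P.prime_ideal (span_singleton_ne_zero hr)

theorem coe_ordRegular (P : H.AffinePoint K) {r : H.CoordRing K} (hr : r ≠ 0) :
    emultiplicity P.ideal (Ideal.span {r}) = ((ordRegular r (some P)).toNat : ℕ∞) := by
  have h := finiteMultiplicity_iff_emultiplicity_ne_top.1 (P.finiteMultiplicity hr)
  simp [ordRegular, ENat.natCast_toNat h]

omit [IsAlgClosed K] in
theorem ordRegular_nonneg (P : H.AffinePoint K) (r : H.CoordRing K) :
    0 ≤ ordRegular r (some P) :=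
  Int.natCast_nonneg _

theorem ordRegular_mul (P : H.Point K) {r s : H.CoordRing K} (hr : r ≠ 0) (hs : s ≠ 0) :
    ordRegular (r * s) P = ordRegular r P + ordRegular s P := by
  rcases P with _ | P
  · simp only [ordRegular]
    rw [map_mul, natDegree_mul (H.norm_ne_zero hr) (H.norm_ne_zero hs)]
    push_cast
    ring
  · simp only [ordRegular]
    rw [← Ideal.span_singleton_mul_span_singleton, emultiplicity_mul P.prime_ideal,
      ENat.toNat_add (finiteMultiplicity_iff_emultiplicity_ne_top.1 (P.finiteMultiplicity hr))
        (finiteMultiplicity_iff_emultiplicity_ne_top.1 (P.finiteMultiplicity hs))]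
    push_cast
    rfl

theorem ordRegular_one (P : H.Point K) : ordRegular (1 : H.CoordRing K) P = 0 := by
  have h := ordRegular_mul P (one_ne_zero (α := H.CoordRing K)) one_ne_zero
  rw [mul_one] at h
  omega

theorem ordRegular_pow (P : H.Point K) {r : H.CoordRing K} (hr : r ≠ 0) (n : ℕ) :
    ordRegular (r ^ n) P = n * ordRegular r P := by
  induction n with
  | zero => simp [ordRegular_one]
  | succ n ih =>
    rw [pow_succ, ordRegular_mul P (pow_ne_zero n hr) hr, ih]
    push_cast
    ring

theorem ordRegular_pos_iff (P : H.AffinePoint K) {r : H.CoordRing K} (hr : r ≠ 0) :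
    0 < ordRegular r (some P) ↔ P.eval r = 0 := by
  rw [← AffinePoint.mem_ideal, ← Ideal.span_singleton_le_iff_mem, ← Ideal.dvd_iff_le,
    ← dvd_iff_emultiplicity_pos, coe_ordRegular P hr]
  simp

theorem dvd_of_ordRegular_le {r s : H.CoordRing K} (hr : r ≠ 0) (hs : s ≠ 0)
    (h : ∀ P : H.AffinePoint K, ordRegular s (some P) ≤ ordRegular r (some P)) : s ∣ r := by
  classical
  rw [← Ideal.mem_span_singleton, ← Ideal.span_singleton_le_iff_mem, ← Ideal.dvd_iff_le,
    UniqueFactorizationMonoid.dvd_iff_normalizedFactors_le_normalizedFactors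
      (span_singleton_ne_zero hs) (span_singleton_ne_zero hr), Multiset.le_iff_count]
  intro p
  by_cases hp : p ∈ UniqueFactorizationMonoid.normalizedFactors (Ideal.span {s})
  · have hpr := UniqueFactorizationMonoid.prime_of_normalized_factor p hp
    obtain ⟨P, rfl⟩ := exists_ideal_eq (Ideal.isPrime_of_prime hpr) hpr.ne_zero
    have key : ∀ {t : H.CoordRing K}, t ≠ 0 → Multiset.count P.ideal
        (UniqueFactorizationMonoid.normalizedFactors (Ideal.span {t})) =
          (ordRegular t (some P)).toNat := fun {t} ht => by
      have := UniqueFactorizationMonoid.emultiplicity_eq_count_normalizedFactors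
        P.prime_ideal.irreducible (span_singleton_ne_zero ht)
      rw [coe_ordRegular P ht, normalize_eq] at this
      exact_mod_cast this.symm
    rw [key hs, key hr]
    exact Int.toNat_le_toNat (h P)
  · rw [Multiset.count_eq_zero_of_notMem hp]
    exact Nat.zero_le _

section Polynomials

omit [IsAlgClosed K] in
theorem ordRegular_polyFun_none (a : K[X]) :
    ordRegular (H.polyFun a) none = -(2 * a.natDegree : ℤ) := by
  simp [ordRegular, norm_polyFun]

theorem emultiplicity_ideal_self (P : H.AffinePoint K) : emultiplicity P.ideal P.ideal = 1 := by
  have := (FiniteMultiplicity.of_prime_left P.prime_ideal P.prime_ideal.ne_zero).emultiplicity_self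
  exact this

theorem emultiplicity_ideal_of_ne {P Q : H.AffinePoint K} (h : P ≠ Q) :
    emultiplicity P.ideal Q.ideal = 0 := by
  rw [emultiplicity_eq_zero, Ideal.dvd_iff_le]
  intro hle
  exact h (AffinePoint.ideal_injective
    (Ideal.IsMaximal.eq_of_le inferInstance (Ideal.IsMaximal.ne_top inferInstance) hle).symm)

theorem ordRegular_X_sub_C_of_ne {P : H.AffinePoint K} (h : P ≠ P.w) :
    ordRegular (H.polyFun (X - C P.x)) (some P) = 1 := by
  simp only [ordRegular]
  rw [P.span_X_sub_C, emultiplicity_mul P.prime_ideal, emultiplicity_ideal_self,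
    emultiplicity_ideal_of_ne h]
  simp

theorem ordRegular_X_sub_C_of_eq {P : H.AffinePoint K} (h : P = P.w) :
    ordRegular (H.polyFun (X - C P.x)) (some P) = 2 := by
  simp only [ordRegular]
  rw [P.span_X_sub_C, ← h, emultiplicity_mul P.prime_ideal, emultiplicity_ideal_self]
  rfl

theorem ordRegular_polyFun (P : H.AffinePoint K) {a : K[X]} (ha : a ≠ 0) :
    ordRegular (H.polyFun a) (some P) =
      a.rootMultiplicity P.x * ordRegular (H.polyFun (X - C P.x)) (some P) := by
  obtain ⟨b, hb, hdvd⟩ := exists_eq_pow_rootMultiplicity_mul_and_not_dvd a ha P.x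
  have hb0 : b ≠ 0 := by rintro rfl; exact hdvd (dvd_zero _)
  have hX := H.polyFun_ne_zero (X_sub_C_ne_zero P.x)
  have h0 : ordRegular (H.polyFun b) (some P) = 0 := by
    refine le_antisymm (not_lt.1 fun h => hdvd ?_) (ordRegular_nonneg _ _)
    rw [ordRegular_pos_iff P (H.polyFun_ne_zero hb0), AffinePoint.eval_polyFun] at h
    exact dvd_iff_isRoot.2 h
  conv_lhs => rw [hb]
  rw [polyFun_mul, polyFun_pow, ordRegular_mul _ (pow_ne_zero _ hX) (H.polyFun_ne_zero hb0), h0,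
    ordRegular_pow _ hX, add_zero]

theorem ordRegular_polyFun_of_ne {P : H.AffinePoint K} (h : P ≠ P.w) {a : K[X]} (ha : a ≠ 0) :
    ordRegular (H.polyFun a) (some P) = a.rootMultiplicity P.x := by
  rw [ordRegular_polyFun P ha, ordRegular_X_sub_C_of_ne h, mul_one]

theorem ordRegular_polyFun_of_eq {P : H.AffinePoint K} (h : P = P.w) {a : K[X]} (ha : a ≠ 0) :
    ordRegular (H.polyFun a) (some P) = a.rootMultiplicity P.x * 2 := by
  rw [ordRegular_polyFun P ha, ordRegular_X_sub_C_of_eq h]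

theorem ordRegular_polyFun_w (P : H.AffinePoint K) {a : K[X]} (ha : a ≠ 0) :
    ordRegular (H.polyFun a) (some P.w) = ordRegular (H.polyFun a) (some P) := by
  by_cases h : P = P.w
  · rw [← h]
  · rw [ordRegular_polyFun_of_ne h ha, ordRegular_polyFun_of_ne _ ha, P.w_x]
    rw [P.w_w]; exact Ne.symm h

theorem ordRegular_C (P : H.Point K) {c : K} (hc : c ≠ 0) :
    ordRegular (H.polyFun (C c)) P = 0 := by
  rcases P with _ | P
  · simp [ordRegular_polyFun_none]
  · rw [ordRegular_polyFun P (C_ne_zero.2 hc)]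
    simp

end Polynomials

section Ord

variable {h h' : H.FunctionField K}

theorem ord_div_algebraMap (P : H.Point K) {r s : H.CoordRing K} (hr : r ≠ 0) (hs : s ≠ 0) :
    ord P (algebraMap _ (H.FunctionField K) r / algebraMap _ (H.FunctionField K) s) =
      ordRegular r P - ordRegular s P := by
  set z := algebraMap _ (H.FunctionField K) r / algebraMap _ (H.FunctionField K) s with hz
  have hs' : algebraMap _ (H.FunctionField K) s ≠ 0 := by simpa using hs
  have hr' : algebraMap _ (H.FunctionField K) r ≠ 0 := by simpa using hr
  have hspec := IsLocalization.sec_spec (nonZeroDivisors (H.CoordRing K)) z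
  set t := IsLocalization.sec (nonZeroDivisors (H.CoordRing K)) z with ht
  have ht2 : (t.2 : H.CoordRing K) ≠ 0 := nonZeroDivisors.coe_ne_zero _
  have ht2' : algebraMap _ (H.FunctionField K) (t.2 : H.CoordRing K) ≠ 0 := by simp
  have ht1 : t.1 ≠ 0 := by
    intro h0
    rw [h0, map_zero] at hspec
    exact mul_ne_zero (div_ne_zero hr' hs') ht2' hspec
  have heq : r * t.2 = s * t.1 := by
    apply IsFractionRing.injective (H.CoordRing K) (H.FunctionField K)
    rw [map_mul, map_mul, ← hspec, hz]
    field_simp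
  have := congrArg (fun x => ordRegular x P) heq
  simp only [ordRegular_mul P hr ht2, ordRegular_mul P hs ht1] at this
  rw [ord, ← ht]
  omega

omit [IsAlgClosed K] in
theorem exists_eq_div (hh : h ≠ 0) : ∃ r s : H.CoordRing K, r ≠ 0 ∧ s ≠ 0 ∧
    h = algebraMap _ (H.FunctionField K) r / algebraMap _ (H.FunctionField K) s := by
  obtain ⟨r, s, hs, rfl⟩ := IsFractionRing.div_surjective (A := H.CoordRing K) h
  refine ⟨r, s, ?_, nonZeroDivisors.ne_zero hs, rfl⟩
  rintro rfl
  simp at hh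

theorem ord_algebraMap (P : H.Point K) {r : H.CoordRing K} (hr : r ≠ 0) :
    ord P (algebraMap _ (H.FunctionField K) r) = ordRegular r P := by
  have := ord_div_algebraMap P hr one_ne_zero
  rwa [map_one, div_one, ordRegular_one, sub_zero] at this

theorem ord_div (P : H.Point K) (hh : h ≠ 0) (hh' : h' ≠ 0) :
    ord P (h / h') = ord P h - ord P h' := by
  obtain ⟨r, s, hr, hs, rfl⟩ := exists_eq_div hh
  obtain ⟨r', s', hr', hs', rfl⟩ := exists_eq_div hh'
  rw [div_div_div_eq, ← map_mul, ← map_mul, ord_div_algebraMap P (mul_ne_zero hr hs')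
    (mul_ne_zero hs hr'), ord_div_algebraMap P hr hs, ord_div_algebraMap P hr' hs',
    ordRegular_mul P hr hs', ordRegular_mul P hs hr']
  ring

theorem ord_one (P : H.Point K) : ord P (1 : H.FunctionField K) = 0 := by
  rw [← map_one (algebraMap (H.CoordRing K) (H.FunctionField K)), ord_algebraMap P one_ne_zero,
    ordRegular_one]

theorem ord_mul (P : H.Point K) (hh : h ≠ 0) (hh' : h' ≠ 0) :
    ord P (h * h') = ord P h + ord P h' := by
  have h1 := ord_div P hh (inv_ne_zero hh')
  have h2 := ord_div P one_ne_zero hh'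
  rw [one_div, ord_one] at h2
  rw [div_inv_eq_mul, h2] at h1
  omega

variable {D D' : H.Divisor K}

theorem HasDivisor.mul (hD : HasDivisor h D) (hD' : HasDivisor h' D') :
    HasDivisor (h * h') (D + D') :=
  ⟨mul_ne_zero hD.1 hD'.1, fun P => by
    rw [ord_mul P hD.1 hD'.1, hD.2, hD'.2, Finsupp.add_apply]⟩

theorem HasDivisor.div (hD : HasDivisor h D) (hD' : HasDivisor h' D') :
    HasDivisor (h / h') (D - D') :=
  ⟨div_ne_zero hD.1 hD'.1, fun P => by
    rw [ord_div P hD.1 hD'.1, hD.2, hD'.2, Finsupp.sub_apply]⟩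

theorem hasDivisor_one : HasDivisor (1 : H.FunctionField K) 0 :=
  ⟨one_ne_zero, fun P => ord_one P⟩

theorem mem_principal : D ∈ H.principal K ↔ ∃ h : H.FunctionField K, HasDivisor h D := by
  refine ⟨fun hD => ?_, fun hD => AddSubgroup.subset_closure hD⟩
  induction hD using AddSubgroup.closure_induction with
  | mem D hD => exact hD
  | zero => exact ⟨1, hasDivisor_one⟩
  | add D D' _ _ h h' =>
    obtain ⟨h, hD⟩ := h
    obtain ⟨h', hD'⟩ := h'
    exact ⟨_, hD.mul hD'⟩
  | neg D _ h =>
    obtain ⟨h, hD⟩ := h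
    exact ⟨_, by simpa using hasDivisor_one.div hD⟩

/-- A function without poles on the affine curve is regular there. -/
theorem exists_eq_algebraMap (hh : h ≠ 0) (hord : ∀ P : H.AffinePoint K, 0 ≤ ord (some P) h) :
    ∃ r : H.CoordRing K, r ≠ 0 ∧ h = algebraMap _ (H.FunctionField K) r := by
  obtain ⟨r, s, hr, hs, rfl⟩ := exists_eq_div hh
  obtain ⟨t, rfl⟩ : s ∣ r := dvd_of_ordRegular_le hr hs fun P => by
    have := hord P
    rw [ord_div_algebraMap _ hr hs] at this
    omega
  refine ⟨t, right_ne_zero_of_mul hr, ?_⟩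
  rw [map_mul, mul_div_cancel_left₀]
  simpa using hs

/-- A function with divisor zero is constant. -/
theorem HasDivisor.eq_const (hD : HasDivisor h 0) :
    ∃ c : K, c ≠ 0 ∧ h = algebraMap _ (H.FunctionField K) (H.polyFun (C c)) := by
  obtain ⟨r, hr, rfl⟩ := exists_eq_algebraMap hD.1 fun P => (hD.2 _).ge
  have hinf := hD.2 none
  rw [ord_algebraMap _ hr] at hinf
  obtain ⟨a, b, rfl⟩ := H.exists_eq_add_mul_yFun r
  by_cases hb : b = 0
  · subst hb
    have hdeg : a.natDegree = 0 := by
      simp only [polyFun_zero, zero_mul, add_zero, ordRegular_polyFun_none] at hinf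
      simpa using hinf
    refine ⟨a.coeff 0, ?_, ?_⟩
    · rintro h0
      rw [eq_C_of_natDegree_eq_zero hdeg, h0] at hr
      simp at hr
    · simp [← eq_C_of_natDegree_eq_zero hdeg]
  · simp only [ordRegular, natDegree_norm _ _ hb, Finsupp.zero_apply] at hinf
    omega

end Ord

end HyperellipticCurve

end

noncomputable section

namespace HyperellipticCurve

variable {k : Type*} [Field k] {g : ℕ} {H : HyperellipticCurve k g}
variable {K : Type*} [Field K] [Algebra k K]
variable {D : H.Divisor K} {r s : ℕ} {P : Fin r → H.AffinePoint K} {Q : Fin s → H.AffinePoint K}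

section Count

open Classical in
theorem IsSemiReducedSum.apply_some (h : IsSemiReducedSum D r P) (R : H.AffinePoint K) :
    D (some R) = ((Finset.univ.val.map P).count R : ℤ) := by
  rw [h.1, Multiset.count_map]
  simp only [Finsupp.sub_apply, Finsupp.smul_apply, Finsupp.coe_finsetSum, Finset.sum_apply]
  simp only [Finsupp.single_apply, Option.some.injEq, reduceCtorEq, if_false, smul_zero, sub_zero,
    Finset.sum_boole]
  rw [← Finset.filter_val, Finset.card_val]
  simp only [eq_comm]

theorem IsSemiReducedSum.map_eq (h : IsSemiReducedSum D r P) (h' : IsSemiReducedSum D s Q) :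
    Finset.univ.val.map P = Finset.univ.val.map Q := by
  classical
  ext R
  have := (h.apply_some R).symm.trans (h'.apply_some R)
  exact_mod_cast this

theorem IsSemiReducedSum.prod_eq (h : IsSemiReducedSum D r P) (h' : IsSemiReducedSum D s Q) :
    ∏ i, (X - C (P i).x) = ∏ i, (X - C (Q i).x) := by
  have := congrArg (fun m => (m.map fun R : H.AffinePoint K => X - C R.x).prod) (h.map_eq h')
  simp only [Multiset.map_map] at this
  exact this

theorem IsSemiReducedSum.exists_eq (h : IsSemiReducedSum D r P) (h' : IsSemiReducedSum D s Q)
    (i : Fin r) : ∃ j, P i = Q j := by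
  have : P i ∈ Finset.univ.val.map P := Multiset.mem_map_of_mem P (Finset.mem_univ i)
  rw [h.map_eq h'] at this
  obtain ⟨j, -, hj⟩ := Multiset.mem_map.1 this
  exact ⟨j, hj.symm⟩

theorem IsSemiReducedSum.nonneg (h : IsSemiReducedSum D r P) (R : H.AffinePoint K) :
    0 ≤ D (some R) := by
  classical
  rw [h.apply_some]
  positivity

theorem IsSemiReducedSum.exists_of_ne_zero (h : IsSemiReducedSum D r P) {R : H.AffinePoint K}
    (hR : D (some R) ≠ 0) : ∃ i, P i = R := by
  classical
  rw [h.apply_some] at hR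
  obtain ⟨i, -, hi⟩ := Multiset.mem_map.1 (Multiset.count_ne_zero.1 (by exact_mod_cast hR))
  exact ⟨i, hi⟩

theorem IsSemiReducedSum.apply_pos (h : IsSemiReducedSum D r P) (i : Fin r) :
    0 < D (some (P i)) := by
  classical
  rw [h.apply_some]
  exact_mod_cast Multiset.count_pos.2 (Multiset.mem_map_of_mem P (Finset.mem_univ i))

theorem IsSemiReducedSum.apply_w (h : IsSemiReducedSum D r P) {R : H.AffinePoint K}
    (hR : R ≠ R.w) : D (some R) = 0 ∨ D (some R.w) = 0 := by
  by_contra! hc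
  obtain ⟨i, rfl⟩ := h.exists_of_ne_zero hc.1
  obtain ⟨j, hj⟩ := h.exists_of_ne_zero hc.2
  refine h.2 i j ?_ (by rw [hj, AffinePoint.w_w])
  rintro rfl
  exact hR hj

theorem IsSemiReducedSum.apply_le_one (h : IsSemiReducedSum D r P) {R : H.AffinePoint K}
    (hR : R = R.w) : D (some R) ≤ 1 := by
  classical
  rw [h.apply_some, Multiset.count_map, ← Finset.filter_val, Finset.card_val]
  norm_cast
  rw [Finset.card_le_one]
  intro i hi j hj
  rw [Finset.mem_filter] at hi hj
  by_contra hij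
  exact h.2 i j hij (by rw [← hi.2, ← hj.2]; exact hR)

/-- The multiplicity of a root of `u = ∏ (x - X_i)` is the multiplicity of the point `P_i`. -/
theorem IsSemiReducedSum.count_x [DecidableEq K] (h : IsSemiReducedSum D r P) (i : Fin r) :
    ((Finset.univ.val.map fun j => (P j).x).count (P i).x : ℤ) = D (some (P i)) := by
  classical
  rw [h.apply_some, Multiset.count_map, Multiset.count_map]
  congr 2
  refine Multiset.filter_congr fun j _ => ⟨fun hx => ?_, fun hx => by rw [hx]⟩
  rcases AffinePoint.eq_or_eq_w hx with hx | hx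
  · exact hx
  · by_cases hij : i = j
    · rw [hij]
    · exact absurd hx (h.2 i j hij)

theorem IsSemiReducedSum.prod_dvd (h : IsSemiReducedSum D r P) {a : K[X]} (ha : a ≠ 0)
    (hle : ∀ i, D (some (P i)) ≤ a.rootMultiplicity (P i).x) : ∏ i, (X - C (P i).x) ∣ a := by
  classical
  have := (Multiset.prod_X_sub_C_dvd_iff_le_roots ha (Finset.univ.val.map fun j => (P j).x)).2 ?_
  · rw [Multiset.map_map] at this
    exact this
  · rw [Multiset.le_iff_count]
    intro α
    by_cases hα : α ∈ Finset.univ.val.map fun j => (P j).x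
    · obtain ⟨i, -, rfl⟩ := Multiset.mem_map.1 hα
      rw [count_roots]
      have := h.count_x i
      have := hle i
      omega
    · rw [Multiset.count_eq_zero_of_notMem hα]
      exact Nat.zero_le _

theorem IsSemiReducedSum.le_rootMultiplicity (h : IsSemiReducedSum D r P) {a : K[X]} (ha : a ≠ 0)
    (hdvd : ∏ i, (X - C (P i).x) ∣ a) (i : Fin r) :
    D (some (P i)) ≤ a.rootMultiplicity (P i).x := by
  classical
  have h1 := (Multiset.prod_X_sub_C_dvd_iff_le_roots ha
    (Finset.univ.val.map fun j => (P j).x)).1 (by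
      rw [Multiset.map_map]
      exact hdvd)
  have h2 := Multiset.le_iff_count.1 h1 (P i).x
  rw [count_roots] at h2
  have := h.count_x i
  omega

end Count

section Mumford

/-- The congruence that makes the second Mumford polynomial unique. -/
theorem IsSemiReducedSum.prod_dvd_sub (h : IsSemiReducedSum D r P) {F v v' : K[X]}
    (hv : ∀ i, v.eval (P i).x = (P i).y) (hv' : ∀ i, v'.eval (P i).x = (P i).y)
    (hF : ∏ i, (X - C (P i).x) ∣ v ^ 2 - F) (hF' : ∏ i, (X - C (P i).x) ∣ v' ^ 2 - F) :
    ∏ i, (X - C (P i).x) ∣ v - v' := by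
  by_cases h0 : v - v' = 0
  · rw [h0]; exact dvd_zero _
  have hdvd : ∏ i, (X - C (P i).x) ∣ (v - v') * (v + v') := by
    convert dvd_sub hF hF' using 1
    ring
  refine h.prod_dvd h0 fun i => ?_
  by_cases hi : P i = (P i).w
  · refine (h.apply_le_one hi).trans ?_
    have : 0 < (v - v').rootMultiplicity (P i).x := by
      rw [rootMultiplicity_pos h0, IsRoot, eval_sub, hv, hv', sub_self]
    omega
  · have hne : (v + v').eval (P i).x ≠ 0 := by
      rw [eval_add, hv, hv', ← two_mul]
      exact mul_ne_zero H.two_ne_zero_of_curve (mt (P i).eq_w_iff.2 hi)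
    have h1 : v + v' ≠ 0 := by
      rintro h1
      simp [h1] at hne
    have h2 := h.le_rootMultiplicity (mul_ne_zero h0 h1) hdvd i
    rwa [rootMultiplicity_mul (mul_ne_zero h0 h1), rootMultiplicity_eq_zero hne, add_zero] at h2

theorem prod_X_sub_C_ne_zero (P : Fin r → H.AffinePoint K) : ∏ i, (X - C (P i).x) ≠ 0 :=
  Finset.prod_ne_zero_iff.2 fun _ _ => X_sub_C_ne_zero _

/-- Uniqueness of the Mumford representation. -/
theorem IsMumford.eq {u v u' v' : K[X]} (h : IsMumford D u v) (h' : IsMumford D u' v') :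
    u = u' ∧ v = v' := by
  obtain ⟨r, P, hP, rfl, hdeg, hv, hF⟩ := h
  obtain ⟨s, Q, hQ, rfl, hdeg', hv', hF'⟩ := h'
  refine ⟨hP.prod_eq hQ, ?_⟩
  rw [← hP.prod_eq hQ] at hdeg' hF'
  have hv'' : ∀ i, v'.eval (P i).x = (P i).y := fun i => by
    obtain ⟨j, hj⟩ := hP.exists_eq hQ i
    rw [hj, hv']
  refine sub_eq_zero.1 (eq_zero_of_dvd_of_degree_lt (hP.prod_dvd_sub hv hv'' hF hF') ?_)
  exact (degree_sub_le _ _).trans_lt (max_lt hdeg hdeg')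

variable [IsAlgClosed K]

omit [IsAlgClosed K] in
theorem sq_sub_f_ne_zero (H : HyperellipticCurve k g) (V : K[X]) :
    V ^ 2 - H.f.map (algebraMap k K) ≠ 0 := by
  intro h
  have h3 := congrArg natDegree (sub_eq_zero.1 h)
  rw [natDegree_pow, natDegree_map_f] at h3
  omega

omit [IsAlgClosed K] in
theorem mul_conj_yFun_sub (V : K[X]) :
    (H.yFun K - H.polyFun V) * H.conj K (H.yFun K - H.polyFun V) =
      H.polyFun (V ^ 2 - H.f.map (algebraMap k K)) := by
  rw [polyFun_sub, ← yFun_sq, map_sub, conj_yFun, conj_polyFun, polyFun_pow]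
  ring

omit [IsAlgClosed K] in
theorem yFun_sub_polyFun_ne_zero (H : HyperellipticCurve k g) (V : K[X]) :
    H.yFun K - H.polyFun V ≠ 0 := by
  intro h
  have h1 := mul_conj_yFun_sub (H := H) V
  rw [h, zero_mul] at h1
  exact H.polyFun_ne_zero (H.sq_sub_f_ne_zero V) h1.symm

/-- The norm `V ^ 2 - f` of `y - V` vanishes at least to the order of `y - V`. -/
theorem ordRegular_yFun_sub_le (V : K[X]) (R : H.AffinePoint K) :
    ordRegular (H.yFun K - H.polyFun V) (some R) ≤
      ordRegular (H.polyFun (V ^ 2 - H.f.map (algebraMap k K))) (some R) := by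
  have h0 := H.yFun_sub_polyFun_ne_zero V
  rw [← mul_conj_yFun_sub, ordRegular_mul _ h0 ((map_ne_zero_iff _ H.conj_injective).2 h0)]
  have := ordRegular_nonneg R (H.conj K (H.yFun K - H.polyFun V))
  omega

/-- A function `y - V` vanishing on a semi-reduced divisor gives its Mumford representation. -/
theorem IsSemiReducedSum.isMumford (h : IsSemiReducedSum D r P) {V : K[X]}
    (hdeg : V.natDegree < r)
    (hord : ∀ i, D (some (P i)) ≤ ordRegular (H.yFun K - H.polyFun V) (some (P i))) :
    IsMumford D (∏ i, (X - C (P i).x)) V := by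
  have hW := H.sq_sub_f_ne_zero V
  refine ⟨r, P, h, rfl, ?_, fun i => ?_, h.prod_dvd hW fun i => ?_⟩
  · refine degree_lt_degree ?_
    rwa [natDegree_prod_of_monic _ _ fun i _ => monic_X_sub_C _, Finset.sum_congr rfl
      fun i _ => natDegree_X_sub_C _, Finset.sum_const, Finset.card_univ, Fintype.card_fin,
      smul_eq_mul, mul_one]
  · have := (ordRegular_pos_iff (P i) (H.yFun_sub_polyFun_ne_zero V)).1
      ((h.apply_pos i).trans_le (hord i))
    rw [map_sub, AffinePoint.eval_yFun, AffinePoint.eval_polyFun] at this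
    exact (sub_eq_zero.1 this).symm
  · have h1 := (hord i).trans (ordRegular_yFun_sub_le V (P i))
    by_cases hi : P i = (P i).w
    · rw [ordRegular_polyFun_of_eq hi hW] at h1
      have := h.apply_le_one hi
      have := h.apply_pos i
      omega
    · rwa [ordRegular_polyFun_of_ne hi hW] at h1

end Mumford

end HyperellipticCurve

end

noncomputable section

namespace HyperellipticCurve

variable {k : Type*} [Field k] [Fintype k] {g : ℕ} {H : HyperellipticCurve k g}
variable {K : Type*} [Field K] [Algebra k K]

theorem exists_algebraMap_of_pow_card {c : K} (hc : c ^ Fintype.card k = c) :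
    ∃ a : k, algebraMap k K a = c := by
  have hroots := FiniteField.roots_X_pow_card_sub_X k
  have hcard : Multiset.card (X ^ Fintype.card k - X : k[X]).roots =
      (X ^ Fintype.card k - X : k[X]).natDegree := by
    rw [hroots, FiniteField.X_pow_card_sub_X_natDegree_eq _ Fintype.one_lt_card]; rfl
  have hmap := roots_map_of_injective_of_card_eq_natDegree (algebraMap k K).injective hcard
  have hmem : c ∈ ((X ^ Fintype.card k - X : k[X]).map (algebraMap k K)).roots := by
    rw [mem_roots]
    · simp [hc]
    · exact map_ne_zero (FiniteField.X_pow_card_sub_X_ne_zero _ Fintype.one_lt_card)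
  rw [← hmap] at hmem
  obtain ⟨a, -, ha⟩ := Multiset.mem_map.1 hmem
  exact ⟨a, ha⟩

theorem exists_map_of_frobPoly_eq {V : K[X]} (hV : frobPoly k V = V) :
    ∃ W : k[X], W.map (algebraMap k K) = V := by
  have : V ∈ lifts (algebraMap k K) := by
    rw [lifts_iff_coeff_lifts]
    intro n
    refine exists_algebraMap_of_pow_card ?_
    conv_rhs => rw [← hV, frobPoly, coeff_map]
    rfl
  obtain ⟨W, hW⟩ := this
  exact ⟨W, hW⟩

theorem frobPoly_map (p : k[X]) : frobPoly k (p.map (algebraMap k K)) = p.map (algebraMap k K) := by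
  rw [frobPoly, map_map]
  congr 1
  exact (FiniteField.frobeniusAlgHom k K).comp_algebraMap

@[simp] theorem AffinePoint.frob_x (P : H.AffinePoint K) : P.frob.x = P.x ^ Fintype.card k := rfl
@[simp] theorem AffinePoint.frob_y (P : H.AffinePoint K) : P.frob.y = P.y ^ Fintype.card k := rfl

theorem pow_card_injective : Function.Injective fun c : K => c ^ Fintype.card k :=
  (FiniteField.frobeniusAlgHom k K).toRingHom.injective

theorem AffinePoint.frob_injective :
    Function.Injective (AffinePoint.frob : H.AffinePoint K → H.AffinePoint K) := fun _ _ h =>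
  AffinePoint.ext (pow_card_injective (k := k) (congrArg AffinePoint.x h))
    (pow_card_injective (k := k) (congrArg AffinePoint.y h))

theorem AffinePoint.frob_w (P : H.AffinePoint K) : P.w.frob = P.frob.w :=
  AffinePoint.ext rfl (map_neg (FiniteField.frobeniusAlgHom k K) P.y)

theorem eval_frobPoly (a : K[X]) (c : K) :
    (frobPoly k a).eval (c ^ Fintype.card k) = a.eval c ^ Fintype.card k :=
  eval_map_apply (f := (FiniteField.frobeniusAlgHom k K : K →+* K)) c

theorem frobDiv_single (P : H.Point K) (n : ℤ) :
    H.frobDiv K (Finsupp.single P n) = Finsupp.single (P.map AffinePoint.frob) n :=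
  Finsupp.mapDomain_single

theorem frobDiv_apply (D : H.Divisor K) (P : H.Point K) :
    H.frobDiv K D (P.map AffinePoint.frob) = D P :=
  Finsupp.mapDomain_apply (Option.map_injective AffinePoint.frob_injective) _ _

variable [Algebra.IsAlgebraic k K]

theorem AffinePoint.frob_surjective :
    Function.Surjective (AffinePoint.frob : H.AffinePoint K → H.AffinePoint K) := by
  intro P
  obtain ⟨x, hx⟩ := (FiniteField.frobeniusAlgEquivOfAlgebraic k K).surjective P.x
  obtain ⟨y, hy⟩ := (FiniteField.frobeniusAlgEquivOfAlgebraic k K).surjective P.y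
  refine ⟨⟨x, y, ?_⟩, AffinePoint.ext hx hy⟩
  apply (FiniteField.frobeniusAlgEquivOfAlgebraic k K).injective
  rw [map_pow, hy, P.equation, ← hx, ← AlgEquiv.coe_toAlgHom, aeval_algHom_apply]

theorem point_map_frob_surjective :
    Function.Surjective (Option.map AffinePoint.frob : H.Point K → H.Point K) :=
  fun P => by
    rcases P with _ | P
    · exact ⟨none, rfl⟩
    · obtain ⟨Q, rfl⟩ := P.frob_surjective
      exact ⟨some Q, rfl⟩

variable (H K)

theorem associated_frobenius_equation :
    Associated ((X ^ 2 - C (H.f.map (algebraMap k K)) : K[X][X]).map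
      (Polynomial.mapAlgEquiv (FiniteField.frobeniusAlgEquivOfAlgebraic k K) : K[X] →+* K[X]))
      (X ^ 2 - C (H.f.map (algebraMap k K))) := by
  have := frobPoly_map (K := K) H.f
  refine .of_eq ?_
  simp only [Polynomial.map_sub, Polynomial.map_pow, map_X, map_C]
  congr 2

/-- The Frobenius on the coefficients of the regular functions: `x ↦ x`, `y ↦ y`. -/
def frobRegular : H.CoordRing K ≃ₐ[k] H.CoordRing K :=
  AdjoinRoot.mapAlgEquiv (Polynomial.mapAlgEquiv (FiniteField.frobeniusAlgEquivOfAlgebraic k K))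
    _ _ (H.associated_frobenius_equation K)

/-- The Frobenius on the coefficients of the rational functions. -/
def frobFunction : H.FunctionField K ≃ₐ[k] H.FunctionField K :=
  IsFractionRing.algEquivOfAlgEquiv (H.frobRegular K)

variable {H K}

@[simp] theorem frobRegular_polyFun (a : K[X]) :
    H.frobRegular K (H.polyFun a) = H.polyFun (frobPoly k a) :=
  AdjoinRoot.map_of _ _ _ (H.associated_frobenius_equation K).symm.dvd _

@[simp] theorem frobRegular_yFun : H.frobRegular K (H.yFun K) = H.yFun K :=
  AdjoinRoot.map_root _ _ _ (H.associated_frobenius_equation K).symm.dvd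

@[simp] theorem frobFunction_algebraMap (r : H.CoordRing K) :
    H.frobFunction K (algebraMap _ _ r) = algebraMap _ _ (H.frobRegular K r) :=
  IsFractionRing.algEquivOfAlgEquiv_algebraMap _ _

theorem frobFunction_eq_self {h : H.FunctionField K} (hh : h ∈ H.rationalFunctions K) :
    H.frobFunction K h = h := by
  induction hh using IntermediateField.adjoin_induction with
  | mem x hx =>
    rcases hx with rfl | rfl
    · simp [frobPoly]
    · simp
  | algebraMap c => exact (H.frobFunction K).commutes c
  | add x y _ _ hx hy => rw [map_add, hx, hy]
  | inv x _ hx => rw [map_inv₀, hx]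
  | mul x y _ _ hx hy => rw [map_mul, hx, hy]

theorem eval_frobRegular (P : H.AffinePoint K) (r : H.CoordRing K) :
    P.frob.eval (H.frobRegular K r) = P.eval r ^ Fintype.card k := by
  obtain ⟨a, b, rfl⟩ := H.exists_eq_add_mul_yFun r
  have hadd : ∀ c d : K, (c + d) ^ Fintype.card k = c ^ Fintype.card k + d ^ Fintype.card k :=
    map_add (FiniteField.frobeniusAlgHom k K)
  simp [eval_frobPoly, hadd, mul_pow]

theorem norm_frobRegular (r : H.CoordRing K) :
    Algebra.norm K[X] (H.frobRegular K r) = frobPoly k (Algebra.norm K[X] r) := by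
  obtain ⟨a, b, rfl⟩ := H.exists_eq_add_mul_yFun r
  simp only [map_add, map_mul, frobRegular_polyFun, frobRegular_yFun, norm_eq]
  conv_lhs => rw [← frobPoly_map (K := K) H.f]
  simp [frobPoly]

theorem map_ideal (P : H.AffinePoint K) :
    P.ideal.map (H.frobRegular K : H.CoordRing K ≃+* H.CoordRing K) = P.frob.ideal := by
  ext r
  obtain ⟨r, rfl⟩ := (H.frobRegular K).surjective r
  rw [AffinePoint.mem_ideal, eval_frobRegular, pow_eq_zero_iff Fintype.card_ne_zero,
    ← AffinePoint.mem_ideal]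
  exact Ideal.apply_mem_of_equiv_iff (f := (H.frobRegular K : H.CoordRing K ≃+* H.CoordRing K))

variable [IsAlgClosed K]

theorem ordRegular_frobRegular (P : H.Point K) (r : H.CoordRing K) :
    ordRegular (H.frobRegular K r) (P.map AffinePoint.frob) = ordRegular r P := by
  rcases P with _ | P
  · simp only [Option.map_none, ordRegular, norm_frobRegular, frobPoly]
    rw [natDegree_map]
  · simp only [Option.map_some, ordRegular]
    congr 2
    rw [emultiplicity_eq_emultiplicity_iff]
    intro n
    rw [Ideal.dvd_iff_le, Ideal.dvd_iff_le, Ideal.span_singleton_le_iff_mem,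
      Ideal.span_singleton_le_iff_mem, ← map_ideal, ← Ideal.map_pow]
    exact Ideal.apply_mem_of_equiv_iff (f := (H.frobRegular K : H.CoordRing K ≃+* H.CoordRing K))

theorem HasDivisor.frob {h : H.FunctionField K} {D : H.Divisor K} (hD : HasDivisor h D) :
    HasDivisor (H.frobFunction K h) (H.frobDiv K D) := by
  refine ⟨(_root_.map_ne_zero _).2 hD.1, fun P => ?_⟩
  obtain ⟨P, rfl⟩ := point_map_frob_surjective P
  rw [frobDiv_apply, ← hD.2]
  obtain ⟨r, s, hr, hs, rfl⟩ := exists_eq_div hD.1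
  have hr' := (map_ne_zero_iff _ (H.frobRegular K).injective).2 hr
  have hs' := (map_ne_zero_iff _ (H.frobRegular K).injective).2 hs
  rw [map_div₀, frobFunction_algebraMap, frobFunction_algebraMap, ord_div_algebraMap _ hr' hs',
    ord_div_algebraMap _ hr hs, ordRegular_frobRegular, ordRegular_frobRegular]

theorem frobDiv_mem_principal {D : H.Divisor K} (hD : D ∈ H.principal K) :
    H.frobDiv K D ∈ H.principal K := by
  obtain ⟨h, hD⟩ := mem_principal.1 hD
  exact mem_principal.2 ⟨_, hD.frob⟩

end HyperellipticCurve

end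

noncomputable section

namespace HyperellipticCurve

variable {k : Type*} [Field k] {g : ℕ} {H : HyperellipticCurve k g}
variable {K : Type*} [Field K] [Algebra k K]

section Reduced

theorem IsSemiReducedSum.apply_none {D : H.Divisor K} {r : ℕ} {P : Fin r → H.AffinePoint K}
    (h : IsSemiReducedSum D r P) : D none = -r := by
  rw [h.1]
  simp

theorem IsSemiReducedSum.add {D D' : H.Divisor K} {r s : ℕ} {P : Fin r → H.AffinePoint K}
    {Q : Fin s → H.AffinePoint K} (h : IsSemiReducedSum D r P) (h' : IsSemiReducedSum D' s Q)
    (hPQ : ∀ i j, P i ≠ (Q j).w) : IsSemiReducedSum (D + D') (r + s) (Fin.append P Q) := by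
  refine ⟨?_, ?_⟩
  · rw [h.1, h'.1, Fin.sum_univ_add]
    simp only [Fin.append_left, Fin.append_right, Nat.cast_add, add_smul]
    abel
  · intro i j hij
    induction i using Fin.addCases with
    | left i =>
      induction j using Fin.addCases with
      | left j =>
        rw [Fin.append_left, Fin.append_left]
        exact h.2 i j fun e => hij (by rw [e])
      | right j =>
        rw [Fin.append_left, Fin.append_right]
        exact hPQ i j
    | right i =>
      induction j using Fin.addCases with
      | left j =>
        rw [Fin.append_left, Fin.append_right]
        intro e
        exact hPQ j i (by rw [e, AffinePoint.w_w])
      | right j =>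
        rw [Fin.append_right, Fin.append_right]
        exact h'.2 i j fun e => hij (by rw [e])

/-- A regular function with a pole of order at most `2 g` at infinity is a polynomial in `x`. -/
theorem exists_eq_polyFun {r : H.CoordRing K} (hr : (Algebra.norm K[X] r).natDegree ≤ 2 * g) :
    ∃ a : K[X], r = H.polyFun a := by
  obtain ⟨a, b, rfl⟩ := H.exists_eq_add_mul_yFun r
  by_cases hb : b = 0
  · exact ⟨a, by simp [hb]⟩
  · rw [natDegree_norm _ _ hb] at hr
    omega

variable [IsAlgClosed K]

theorem ordRegular_prod {ι : Type*} (S : Finset ι) (f : ι → H.CoordRing K)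
    (hf : ∀ i ∈ S, f i ≠ 0) (P : H.Point K) :
    ordRegular (∏ i ∈ S, f i) P = ∑ i ∈ S, ordRegular (f i) P := by
  classical
  induction S using Finset.induction_on with
  | empty => simp [ordRegular_one]
  | insert i S hi ih =>
    rw [Finset.prod_insert hi, Finset.sum_insert hi, ordRegular_mul, ih]
    · exact fun j hj => hf j (Finset.mem_insert_of_mem hj)
    · exact hf i (Finset.mem_insert_self _ _)
    · exact Finset.prod_ne_zero_iff.2 fun j hj => hf j (Finset.mem_insert_of_mem hj)

open Classical in
theorem ordRegular_X_sub_C (P R : H.AffinePoint K) :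
    ordRegular (H.polyFun (X - C P.x)) (some R) =
      (if P = R then 1 else 0) + (if P = R.w then 1 else 0) := by
  have key : ∀ Q : H.AffinePoint K, emultiplicity R.ideal Q.ideal = if Q = R then 1 else 0 := by
    intro Q
    split_ifs with h
    · rw [h, emultiplicity_ideal_self]
    · exact emultiplicity_ideal_of_ne (Ne.symm h)
  have hw : P.w = R ↔ P = R.w := by
    constructor <;> rintro rfl <;> simp
  simp only [ordRegular]
  rw [P.span_X_sub_C, emultiplicity_mul R.prime_ideal, key, key, hw]
  split_ifs <;> rfl

/-- The divisor of `u = ∏ (x - X_i)` is `D + w(D)`. -/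
theorem IsSemiReducedSum.ordRegular_prod_X_sub_C {D : H.Divisor K} {r : ℕ}
    {P : Fin r → H.AffinePoint K} (h : IsSemiReducedSum D r P) (R : H.AffinePoint K) :
    ordRegular (H.polyFun (∏ i, (X - C (P i).x))) (some R) = D (some R) + D (some R.w) := by
  classical
  have hD : ∀ R : H.AffinePoint K, D (some R) = ∑ i, if P i = R then 1 else 0 := fun R => by
    rw [h.1]
    simp [Finsupp.single_apply]
  rw [show H.polyFun (∏ i, (X - C (P i).x)) = ∏ i, H.polyFun (X - C (P i).x) from map_prod _ _ _,
    ordRegular_prod _ _ fun i _ => H.polyFun_ne_zero (X_sub_C_ne_zero _), hD, hD,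
    ← Finset.sum_add_distrib]
  exact Finset.sum_congr rfl fun i _ => ordRegular_X_sub_C _ _

/-- Every divisor class contains at most one reduced divisor. -/
theorem IsReduced.eq_of_sub_mem_principal {D D' : H.Divisor K} (hD : IsReduced D)
    (hD' : IsReduced D') (h : D - D' ∈ H.principal K) : D = D' := by
  obtain ⟨r, P, hP, hr⟩ := hD
  obtain ⟨s, Q, hQ, hs⟩ := hD'
  obtain ⟨h, h0, hord⟩ := mem_principal.1 h
  set u := ∏ i, (X - C (Q i).x) with hu
  have hu0 : H.polyFun u ≠ 0 := H.polyFun_ne_zero (prod_X_sub_C_ne_zero Q)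
  have hu1 : algebraMap _ (H.FunctionField K) (H.polyFun u) ≠ 0 := by simpa using hu0
  have hz : ∀ R : H.AffinePoint K, ord (some R) (h * algebraMap _ _ (H.polyFun u)) =
      D (some R) + D' (some R.w) := fun R => by
    rw [ord_mul _ h0 hu1, ord_algebraMap _ hu0, hu, hQ.ordRegular_prod_X_sub_C, hord,
      Finsupp.sub_apply]
    ring
  have hzinf : ord none (h * algebraMap _ _ (H.polyFun u)) = -(r + s : ℤ) := by
    have hdeg : u.natDegree = s := by
      rw [hu, natDegree_prod_of_monic _ _ fun i _ => monic_X_sub_C _]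
      simp
    rw [ord_mul _ h0 hu1, ord_algebraMap _ hu0, ordRegular_polyFun_none, hdeg, hord,
      Finsupp.sub_apply, hP.apply_none, hQ.apply_none]
    ring
  obtain ⟨t, ht0, ht⟩ := exists_eq_algebraMap (mul_ne_zero h0 hu1) fun R => by
    rw [hz]
    exact add_nonneg (hP.nonneg R) (hQ.nonneg R.w)
  rw [ht, ord_algebraMap _ ht0] at hzinf
  obtain ⟨a, rfl⟩ := exists_eq_polyFun (r := t) (by simp only [ordRegular] at hzinf; omega)
  have ha : a ≠ 0 := by
    rintro rfl
    simp at ht0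
  have hsum : ∀ R : H.AffinePoint K,
      ordRegular (H.polyFun a) (some R) = D (some R) + D' (some R.w) := fun R => by
    rw [← ord_algebraMap _ ht0, ← ht, hz]
  have haff : ∀ R : H.AffinePoint K, D (some R) = D' (some R) := fun R => by
    have h1 := hsum R
    have hn1 := hP.nonneg R
    have hn2 := hQ.nonneg R
    by_cases hR : R = R.w
    · rw [ordRegular_polyFun_of_eq hR ha, ← hR] at h1
      have := hP.apply_le_one hR
      have := hQ.apply_le_one hR
      omega
    · have h2 := hsum R.w
      rw [ordRegular_polyFun_w R ha, AffinePoint.w_w] at h2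
      have hn3 := hP.nonneg R.w
      have hn4 := hQ.nonneg R.w
      have := hP.apply_w hR
      have := hQ.apply_w hR
      omega
  have hrs : r = s := by
    classical
    have hmap : Finset.univ.val.map P = Finset.univ.val.map Q := by
      ext R
      have := haff R
      rw [hP.apply_some, hQ.apply_some] at this
      exact_mod_cast this
    simpa using congrArg Multiset.card hmap
  ext R
  rcases R with _ | R
  · rw [hP.apply_none, hQ.apply_none, hrs]
  · exact haff R

end Reduced

section TraceZero

variable [Fintype k]

theorem IsSemiReducedSum.frob {D : H.Divisor K} {r : ℕ} {P : Fin r → H.AffinePoint K}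
    (h : IsSemiReducedSum D r P) :
    IsSemiReducedSum (H.frobDiv K D) r (fun i => (P i).frob) := by
  refine ⟨?_, fun i j hij e => h.2 i j hij (AffinePoint.frob_injective ?_)⟩
  · rw [h.1, map_sub, map_sum, map_zsmul]
    simp only [frobDiv_single, Option.map_some, Option.map_none]
  · rw [AffinePoint.frob_w]
    exact e

theorem IsReduced.frob {D : H.Divisor K} (h : IsReduced D) : IsReduced (H.frobDiv K D) := by
  obtain ⟨r, P, hP, hr⟩ := h
  exact ⟨r, _, hP.frob, hr⟩

theorem frobPoly_prod {r : ℕ} (P : Fin r → H.AffinePoint K) :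
    frobPoly k (∏ i, (X - C (P i).x)) = ∏ i, (X - C (P i).frob.x) := by
  simp [frobPoly, Polynomial.map_prod]

theorem IsMumford.frob {D : H.Divisor K} {u v : K[X]} (h : IsMumford D u v) :
    IsMumford (H.frobDiv K D) (frobPoly k u) (frobPoly k v) := by
  obtain ⟨r, P, hP, rfl, hdeg, hv, hF⟩ := h
  refine ⟨r, _, hP.frob, frobPoly_prod P, ?_, fun i => ?_, ?_⟩
  · rwa [frobPoly, frobPoly, degree_map, degree_map]
  · rw [AffinePoint.frob_x, eval_frobPoly, hv, AffinePoint.frob_y]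
  · have := Polynomial.map_dvd (FiniteField.frobeniusAlgHom k K : K →+* K) hF
    rw [Polynomial.map_sub, Polynomial.map_pow] at this
    rwa [← frobPoly_map H.f]

omit [Fintype k] in
/-- The Mumford polynomial is determined modulo `u` by its values and `u ∣ V ^ 2 - f`. -/
theorem IsMumford.dvd_sub {D : H.Divisor K} {u v V : K[X]} (h : IsMumford D u v)
    (hV : ∀ R : H.AffinePoint K, 0 < D (some R) → V.eval R.x = R.y)
    (hF : u ∣ V ^ 2 - H.f.map (algebraMap k K)) : u ∣ V - v := by
  obtain ⟨r, P, hP, rfl, -, hv, hF'⟩ := h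
  exact hP.prod_dvd_sub (fun i => hV _ (hP.apply_pos i)) hv hF hF'

variable [Algebra.IsAlgebraic k K] [IsAlgClosed K]

theorem frobDiv_pow_mem_principal {D : H.Divisor K} (hD : D ∈ H.principal K) (n : ℕ) :
    (H.frobDiv K ^ n : AddMonoid.End (H.Divisor K)) D ∈ H.principal K := by
  induction n with
  | zero => exact hD
  | succ n ih =>
    rw [pow_succ']
    exact frobDiv_mem_principal ih

omit [Algebra.IsAlgebraic k K] [IsAlgClosed K] in
theorem trace_apply (n : ℕ) (D : H.Divisor K) :
    H.trace K n D =
      ∑ i ∈ Finset.range n, (H.frobDiv K ^ i : AddMonoid.End (H.Divisor K)) D := by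
  induction n with
  | zero => rfl
  | succ n ih =>
    rw [Finset.sum_range_succ, ← ih, trace, Finset.sum_range_succ]
    rfl

theorem trace_mem_principal {D : H.Divisor K} (hD : D ∈ H.principal K) (n : ℕ) :
    H.trace K n D ∈ H.principal K := by
  rw [trace_apply]
  exact sum_mem fun i _ => frobDiv_pow_mem_principal hD i

/-- A reduced divisor whose class lies in the trace zero subgroup is itself rational over the
extension of degree `n`, and its trace is principal. -/
theorem of_divClass_mem_traceZero {D : H.DivZero K} (hD : IsReduced (D : H.Divisor K)) {n : ℕ}
    (hT : divClass D ∈ H.traceZero K n) :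
    (H.frobDiv K ^ n : AddMonoid.End (H.Divisor K)) D = D ∧ H.trace K n D ∈ H.principal K := by
  obtain ⟨D', hD', heq⟩ := hT
  obtain ⟨hfix, htr⟩ : (H.frobDiv K ^ n : AddMonoid.End (H.Divisor K)) D' = D' ∧
      H.trace K n D' ∈ H.principal K := hD'
  have hsub : (D : H.Divisor K) - D' ∈ H.principal K := by
    have := (QuotientAddGroup.eq).1 heq
    rw [AddSubgroup.mem_addSubgroupOf] at this
    simpa [sub_eq_neg_add] using this
  constructor
  · have hred : ∀ m, IsReduced ((H.frobDiv K ^ m : AddMonoid.End (H.Divisor K)) D) := fun m => by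
      induction m with
      | zero => exact hD
      | succ m ih =>
        rw [pow_succ']
        exact ih.frob
    refine (hred n).eq_of_sub_mem_principal hD ?_
    have := sub_mem (frobDiv_pow_mem_principal hsub n) hsub
    rw [map_sub, hfix] at this
    simpa using this
  · have := add_mem (trace_mem_principal hsub n) htr
    rwa [map_sub, sub_add_cancel] at this

end TraceZero

end HyperellipticCurve

end

noncomputable section

namespace HyperellipticCurve

variable {k : Type*} [Field k] {g : ℕ} {H : HyperellipticCurve k g}
variable {K : Type*} [Field K] [Algebra k K]

/-- A sum of two points that is a reduced divisor is in reduced form. -/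
theorem IsReduced.isSemiReducedSum_pair {D : H.Divisor K} {P₁ P₂ : H.AffinePoint K}
    (hD : D = Finsupp.single (some P₁) 1 + Finsupp.single (some P₂) 1
      - (2 : ℤ) • Finsupp.single none 1) (hred : IsReduced D) :
    IsSemiReducedSum D 2 ![P₁, P₂] := by
  classical
  obtain ⟨r, P, hP, -⟩ := hred
  have happ : ∀ R : H.AffinePoint K,
      D (some R) = (if P₁ = R then 1 else 0) + (if P₂ = R then 1 else 0) := fun R => by
    rw [hD]
    simp [Finsupp.single_apply]
  have hne : P₁ ≠ P₂.w := by
    rintro rfl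
    by_cases h : P₂ = P₂.w
    · have := hP.apply_le_one h
      rw [happ, if_pos h.symm, if_pos rfl] at this
      omega
    · have h1 := happ P₂
      have h2 := happ P₂.w
      have := hP.apply_w h
      rw [if_neg (Ne.symm h), if_pos rfl] at h1
      rw [if_pos rfl, if_neg h] at h2
      omega
  refine ⟨by rw [hD]; simp, fun i j hij => ?_⟩
  fin_cases i <;> fin_cases j
  · exact absurd rfl hij
  · exact hne
  · intro (h : P₂ = P₁.w)
    exact hne (by rw [h, AffinePoint.w_w])
  · exact absurd rfl hij

theorem yFun_sub_polyFun_mem_rationalFunctions (V : k[X]) :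
    algebraMap (H.CoordRing K) (H.FunctionField K)
      (H.yFun K - H.polyFun (V.map (algebraMap k K))) ∈ H.rationalFunctions K := by
  rw [map_sub]
  refine sub_mem (IntermediateField.subset_adjoin _ _ (by simp)) ?_
  have hx : algebraMap (H.CoordRing K) (H.FunctionField K) (H.polyFun X) ∈
      H.rationalFunctions K := IntermediateField.subset_adjoin _ _ (by simp)
  have hc : ∀ c : k, algebraMap (H.CoordRing K) (H.FunctionField K)
      (H.polyFun (C (algebraMap k K c))) = algebraMap k (H.FunctionField K) c := fun c => rfl
  induction V using Polynomial.induction_on' with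
  | add p q hp hq =>
    rw [Polynomial.map_add, polyFun_add, map_add]
    exact add_mem hp hq
  | monomial n c =>
    rw [map_monomial, ← C_mul_X_pow_eq_monomial, polyFun_mul, map_mul, hc, polyFun_pow, map_pow]
    exact mul_mem (algebraMap_mem _ c) (pow_mem hx n)

variable [IsAlgClosed K]

theorem hasDivisor_C {c : K} (hc : c ≠ 0) :
    HasDivisor (algebraMap (H.CoordRing K) (H.FunctionField K) (H.polyFun (C c))) 0 := by
  have h0 := H.polyFun_ne_zero (C_ne_zero.2 hc)
  exact ⟨by simpa using h0, fun P => by rw [ord_algebraMap P h0, ordRegular_C P hc]; rfl⟩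

/-- A function of pole divisor `(2 g + 2) O` whose divisor is not that of a polynomial in `x` is,
up to a constant, of the form `y - V` with `deg V = g + 1`. -/
theorem HasDivisor.exists_eq_yFun_sub {h : H.FunctionField K} {T : H.Divisor K}
    (hT : HasDivisor h T) (hpos : ∀ R : H.AffinePoint K, 0 ≤ T (some R))
    (hinf : T none = -(2 * g + 2 : ℤ))
    (hpoly : ∀ a : K[X], a ≠ 0 →
      ¬ ∀ R : H.AffinePoint K, T (some R) = ordRegular (H.polyFun a) (some R)) :
    ∃ V : K[X], V.natDegree = g + 1 ∧
      HasDivisor (algebraMap (H.CoordRing K) (H.FunctionField K) (H.yFun K - H.polyFun V)) T := by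
  obtain ⟨r, hr, rfl⟩ := exists_eq_algebraMap hT.1 fun R => (hpos R).trans_eq (hT.2 _).symm
  have hord : ∀ P, ordRegular r P = T P := fun P => by rw [← hT.2, ord_algebraMap P hr]
  have hdeg := hord none
  obtain ⟨a, b, rfl⟩ := H.exists_eq_add_mul_yFun r
  by_cases hb : b = 0
  · subst hb
    simp only [polyFun_zero, zero_mul, add_zero] at hr hord
    refine absurd (fun R => (hord (some R)).symm) (hpoly a ?_)
    rintro rfl
    simp at hr
  · simp only [ordRegular, natDegree_norm _ _ hb, hinf] at hdeg
    obtain ⟨c, hc⟩ := natDegree_eq_zero.1 (show b.natDegree = 0 by omega)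
    subst hc
    have hc : c ≠ 0 := by simpa using hb
    have ha : a.natDegree = g + 1 := by
      rw [natDegree_C] at hdeg
      omega
    refine ⟨-(C c⁻¹ * a), ?_, ?_⟩
    · rw [natDegree_neg, natDegree_C_mul (inv_ne_zero hc), ha]
    · have := (hasDivisor_C (H := H) (inv_ne_zero hc)).mul hT
      rw [zero_add, ← map_mul] at this
      convert this using 2
      have hcc : H.polyFun (C c⁻¹) * H.polyFun (C c) = 1 := by
        rw [← polyFun_mul, ← C_mul, inv_mul_cancel₀ hc, C_1, polyFun_one]
      rw [polyFun_neg, polyFun_mul]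
      linear_combination (-H.yFun K) * hcc

variable [Fintype k] [Algebra.IsAlgebraic k K]

omit [IsAlgClosed K] in
theorem frobFunction_yFun_sub (V : K[X]) :
    H.frobFunction K (algebraMap _ _ (H.yFun K - H.polyFun V)) =
      algebraMap _ _ (H.yFun K - H.polyFun (frobPoly k V)) := by
  rw [frobFunction_algebraMap, map_sub, frobRegular_yFun, frobRegular_polyFun]

/-- If `y - V` with `V` over `k` has divisor `Tr(D)`, the trace functions of `D` are its multiples
by nonzero constants of `k`. -/
theorem isTraceFunction_iff {n : ℕ} {D : H.Divisor K} {V : k[X]}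
    (hV : HasDivisor (algebraMap (H.CoordRing K) (H.FunctionField K)
      (H.yFun K - H.polyFun (V.map (algebraMap k K)))) (H.trace K n D)) (h : H.FunctionField K) :
    IsTraceFunction n D h ↔ ∃ c : k, c ≠ 0 ∧ h = algebraMap k (H.FunctionField K) c *
      algebraMap (H.CoordRing K) (H.FunctionField K)
        (H.yFun K - H.polyFun (V.map (algebraMap k K))) := by
  constructor
  · rintro ⟨hmem, hdiv⟩
    have hmem' := yFun_sub_polyFun_mem_rationalFunctions (H := H) (K := K) V
    have h0 := hdiv.div hV
    rw [sub_self] at h0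
    obtain ⟨c, hc, heq⟩ := h0.eq_const
    have hfix := frobFunction_eq_self (div_mem hmem hmem')
    rw [heq, frobFunction_algebraMap, frobRegular_polyFun] at hfix
    have hfix' := H.polyFun_injective (IsFractionRing.injective _ (H.FunctionField K) hfix)
    rw [frobPoly, map_C, C_inj] at hfix'
    obtain ⟨c, rfl⟩ := exists_algebraMap_of_pow_card (k := k) hfix'
    exact ⟨c, fun h => hc (by rw [h, map_zero]), (div_eq_iff hV.1).1 heq⟩
  · rintro ⟨c, hc, rfl⟩
    refine ⟨mul_mem (algebraMap_mem _ c) (yFun_sub_polyFun_mem_rationalFunctions V), ?_⟩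
    have := (hasDivisor_C (H := H) ((_root_.map_ne_zero (algebraMap k K)).2 hc)).mul hV
    rwa [zero_add] at this

end HyperellipticCurve

end

noncomputable section

namespace HyperellipticCurve

variable {k : Type*} [Field k] [Fintype k] {g : ℕ} {H : HyperellipticCurve k g}
variable {K : Type*} [Field K] [Algebra k K]

theorem trace_three (D : H.Divisor K) :
    H.trace K 3 D = D + H.frobDiv K D + H.frobDiv K (H.frobDiv K D) := by
  rw [trace_apply, Finset.sum_range_succ, Finset.sum_range_succ, Finset.sum_range_one]
  rfl

/-- Coprimality of `u` and `u^φ`: no point of `D` has the same `x` as a point of `φ(D)`. -/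
theorem x_ne_frob_x_of_isCoprime {r : ℕ} {P : Fin r → H.AffinePoint K}
    (h : IsCoprime (∏ i, (X - C (P i).x)) (frobPoly k (∏ i, (X - C (P i).x)))) (i j : Fin r) :
    (P i).x ≠ (P j).frob.x := by
  intro hij
  have hroot : ∀ (Q : Fin r → H.AffinePoint K) (i : Fin r),
      (∏ j, (X - C (Q j).x)).eval (Q i).x = 0 := fun Q i => by
    rw [eval_prod]
    exact Finset.prod_eq_zero (Finset.mem_univ i) (by simp)
  obtain ⟨s, t, hst⟩ := h
  have := congrArg (eval (P i).x) hst
  rw [eval_add, eval_mul, eval_mul, hroot, hij, frobPoly_prod, hroot fun i => (P i).frob] at this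
  simp at this

/-- `V = s u + v` with `s ≡ (v' - v) / u` modulo `u'`. -/
theorem exists_quotient_of_dvd_sub {u u' v v' V : K[X]} (hcop : IsCoprime u u')
    (hv : v.degree < u.degree) (hV : V.degree < (u * u').degree) (h : u ∣ V - v) (h' : u' ∣ V - v') :
    ∃ s : K[X], (∀ t : K[X], (t.degree < u'.degree ∧ u' ∣ u * t - (v' - v)) ↔ t = s) ∧
      V = s * u + v := by
  obtain ⟨s, hs⟩ := h
  have hs' : V - v' = u * s - (v' - v) := by rw [← hs]; ring
  have hu' : u' ≠ 0 := by rintro rfl; simp at hV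
  have hdeg : s.degree < u'.degree := by
    have h1 : (u * s).degree < (u * u').degree := by
      rw [← hs]
      refine (degree_sub_le _ _).trans_lt (max_lt hV (hv.trans_le ?_))
      exact degree_le_mul_left _ hu'
    rw [degree_mul, degree_mul] at h1
    exact lt_of_add_lt_add_left h1
  refine ⟨s, fun t => ⟨fun ⟨ht, hdvd⟩ => ?_, ?_⟩, by linear_combination hs⟩
  · rw [hs'] at h'
    have h2 : u' ∣ u * (t - s) := by
      convert dvd_sub hdvd h' using 1
      ring
    refine sub_eq_zero.1 (eq_zero_of_dvd_of_degree_lt (hcop.symm.dvd_of_dvd_mul_left h2) ?_)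
    exact (degree_sub_le _ _).trans_lt (max_lt ht hdeg)
  · rintro rfl
    exact ⟨hdeg, hs' ▸ h'⟩

end HyperellipticCurve

end

theorem mainTheorem10 {k : Type*} [Field k] [Fintype k]
    {K : Type*} [Field K] [Algebra k K] [IsAlgClosure k K]
    (H : HyperellipticCurve k 2)
    (D : H.DivZero K) (P₁ P₂ : H.AffinePoint K)
    (hD : (D : H.Divisor K) = Finsupp.single (some P₁) 1 + Finsupp.single (some P₂) 1
      - (2 : ℤ) • Finsupp.single none 1)
    (hred : HyperellipticCurve.IsReduced (D : H.Divisor K))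
    (hT : HyperellipticCurve.divClass D ∈ H.traceZero K 3)
    (hne : HyperellipticCurve.divClass D ≠ 0)
    (u v : K[X]) (huv : HyperellipticCurve.IsMumford (D : H.Divisor K) u v)
    (hP : P₁ ≠ P₂.frob.w) (hP' : P₁ ≠ P₂.frob.frob.w)
    (hgcd : IsCoprime u (HyperellipticCurve.frobPoly k u)) :
    HyperellipticCurve.IsSemiReduced ((D : H.Divisor K) + H.frobDiv K D) ∧
    ∃ (U : K[X]) (V : k[X]),
      -- `[U, V]` is the Mumford representation of `D + φ(D)`, and `V` has coefficients in `k`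
      (∀ U' V' : K[X],
        HyperellipticCurve.IsMumford ((D : H.Divisor K) + H.frobDiv K D) U' V' ↔
          U' = U ∧ V' = V.map (algebraMap k K)) ∧
      -- `h_D = y - V`, up to multiplication by nonzero constants of `k`
      (∀ h : H.FunctionField K,
        HyperellipticCurve.IsTraceFunction 3 (D : H.Divisor K) h ↔
          ∃ c : k, c ≠ 0 ∧ h = algebraMap k (H.FunctionField K) c *
            algebraMap (H.CoordRing K) (H.FunctionField K)
              (H.yFun K - H.polyFun (V.map (algebraMap k K)))) ∧
      -- `V = s u + v`, where `s` is `(v^φ - v) / u` reduced modulo `u^φ`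
      ∃ s : K[X],
        (∀ t : K[X],
          (t.degree < (HyperellipticCurve.frobPoly k u).degree ∧
            HyperellipticCurve.frobPoly k u ∣
              u * t - (HyperellipticCurve.frobPoly k v - v)) ↔ t = s) ∧
        V.map (algebraMap k K) = s * u + v := by
  open HyperellipticCurve in
  have : IsAlgClosed K := IsAlgClosure.isAlgClosed k
  have : Algebra.IsAlgebraic k K := IsAlgClosure.isAlgebraic
  obtain ⟨hfix, htr⟩ := of_divClass_mem_traceZero hred hT
  replace hfix : H.frobDiv K (H.frobDiv K (H.frobDiv K D)) = D := hfix
  have hS := hred.isSemiReducedSum_pair hD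
  generalize ![P₁, P₂] = P at hS
  generalize (D : H.Divisor K) = D at *
  have hu : u = ∏ i, (X - C (P i).x) := by
    obtain ⟨r, Q, hQ, hu, -⟩ := huv
    exact hu.trans (hQ.prod_eq hS)
  have hx : ∀ i j, (P i).x ≠ (P j).frob.x := x_ne_frob_x_of_isCoprime (hu ▸ hgcd)
  have hS₁ := hS.frob
  have hS₂ := hS₁.frob
  have hS₃ := hS₂.frob
  rw [hfix] at hS₃
  have hx₂ : ∀ i j, (P i).x ≠ (P j).frob.frob.x := fun i j h => by
    obtain ⟨l, hl⟩ := hS₃.exists_eq hS j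
    refine hx l i ?_
    rw [← hl, AffinePoint.frob_x, ← h, AffinePoint.frob_x]
  have hE := hS.add hS₁ fun i j h => hx i j (congrArg AffinePoint.x h :)
  obtain ⟨h, hdiv⟩ := mem_principal.1 htr
  have hTr : ∀ R, H.trace K 3 D R = (D + H.frobDiv K D) R + H.frobDiv K (H.frobDiv K D) R :=
    fun R => by rw [trace_three, Finsupp.add_apply]
  -- the function is not a polynomial in `x`
  have hpoly : ∀ a : K[X], a ≠ 0 →
      ¬ ∀ R : H.AffinePoint K, H.trace K 3 D (some R) = ordRegular (H.polyFun a) (some R) := by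
    intro a ha hcontra
    have hTrx : ∀ R : H.AffinePoint K, R.x = (P 0).x → H.trace K 3 D (some R) = D (some R) := by
      intro R hR
      have h1 : H.frobDiv K D (some R) = 0 := by
        by_contra h1
        obtain ⟨j, rfl⟩ := hS₁.exists_of_ne_zero h1
        exact hx 0 j hR.symm
      have h2 : H.frobDiv K (H.frobDiv K D) (some R) = 0 := by
        by_contra h2
        obtain ⟨j, rfl⟩ := hS₂.exists_of_ne_zero h2
        exact hx₂ 0 j hR.symm
      rw [hTr, Finsupp.add_apply, h1, h2, add_zero, add_zero]
    have h1 := hTrx (P 0) rfl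
    have h2 := hTrx (P 0).w rfl
    rw [hcontra] at h1 h2
    have hpos := hS.apply_pos 0
    by_cases hw : P 0 = (P 0).w
    · rw [ordRegular_polyFun_of_eq hw ha] at h1
      have := hS.apply_le_one hw
      omega
    · rw [ordRegular_polyFun_w _ ha] at h2
      have := hS.apply_w hw
      omega
  obtain ⟨V, hVdeg, hVdiv⟩ := hdiv.exists_eq_yFun_sub
    (fun R => by
      rw [hTr]
      exact add_nonneg (hE.nonneg R) (hS₂.nonneg R))
    (by
      rw [hTr, hE.apply_none, hS₂.apply_none]
      norm_num) hpoly
  have hmum : ∀ W : K[X], W.natDegree = 2 + 1 →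
      HasDivisor (algebraMap (H.CoordRing K) (H.FunctionField K) (H.yFun K - H.polyFun W))
        (H.trace K 3 D) → IsMumford (D + H.frobDiv K D) (u * frobPoly k u) W := by
    intro W hW hWdiv
    convert hE.isMumford (V := W) (by omega) fun i => ?_ using 1
    · rw [Fin.prod_univ_add, hu, frobPoly_prod]
      simp only [Fin.append_left, Fin.append_right]
    · rw [← ord_algebraMap _ (H.yFun_sub_polyFun_ne_zero W), hWdiv.2, hTr]
      exact le_add_of_nonneg_right (hS₂.nonneg _)
  have hVmum := hmum V hVdeg hVdiv
  have hVfrob : frobPoly k V = V := by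
    refine ((hmum _ (by rw [frobPoly, natDegree_map, hVdeg]) ?_).eq hVmum).2
    have := hVdiv.frob
    rw [frobFunction_yFun_sub] at this
    convert this using 1
    rw [trace_three, map_add, map_add, hfix]
    abel
  obtain ⟨V, rfl⟩ := exists_map_of_frobPoly_eq hVfrob
  refine ⟨⟨_, _, hE⟩, u * frobPoly k u, V, fun U' V' => ⟨fun h => h.eq hVmum, ?_⟩,
    isTraceFunction_iff hVdiv, ?_⟩
  · rintro ⟨rfl, rfl⟩
    exact hVmum
  · have hdvd : u * frobPoly k u ∣ (V.map (algebraMap k K)) ^ 2 - H.f.map (algebraMap k K) := by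
      obtain ⟨_, _, -, -, -, -, h⟩ := hVmum
      exact h
    have heval : ∀ R : H.AffinePoint K, 0 < D (some R) + H.frobDiv K D (some R) →
        (V.map (algebraMap k K)).eval R.x = R.y := by
      intro R hR
      obtain ⟨_, Q, hQ, -, -, h, -⟩ := hVmum
      obtain ⟨i, rfl⟩ := hQ.exists_of_ne_zero (R := R) (by rw [Finsupp.add_apply]; omega)
      exact h i
    refine exists_quotient_of_dvd_sub hgcd ?_ ?_ (huv.dvd_sub (fun R hR => heval R ?_) ?_)
      (huv.frob.dvd_sub (fun R hR => heval R ?_) ?_)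
    · obtain ⟨_, _, -, -, h, -, -⟩ := huv
      exact h
    · obtain ⟨_, _, -, -, h, -, -⟩ := hVmum
      exact h
    · have := hS₁.nonneg R
      omega
    · exact (dvd_mul_right _ _).trans hdvd
    · have := hS.nonneg R
      omega
    · exact (dvd_mul_left _ _).trans hdvd
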